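/- Let $\ell$ be an odd prime and let $G$ be a subgroup of $\mathrm{GL}_2(\mathbb F_\ell)$. Write $\overline{G}$ for the image of $G$ in $\mathrm{PGL}_2(\mathbb F_\ell)=\mathrm{GL}_2(\mathbb F_\ell)/\{\text{scalars}\}$, write $\mathrm{PSL}_2(\mathbb F_\ell)\subseteq \mathrm{PGL}_2(\mathbb F_\ell)$ for the image of $\mathrm{SL}_2(\mathbb F_\ell)$, and let $$\mathcal F(G)=\frac{|\{\gamma\in G:\gamma\text{ has an eigenvalue in }\mathbb F_\ell\}|}{|G|}.$$ Fix a non-square $\varepsilon\in\mathbb F_\ell^\times$ and consider the following subgroups of $\mathrm{GL}_2(\mathbb F_\ell)$: the group $\mathcal B$ of invertible upper triangular matrices; the group $\mathcal C_s$ of invertible diagonal matrices; $\mathcal C_s^+=\mathcal C_s\cup\begin{pmatrix}0&1\\1&0\end{pmatrix}\mathcal C_s$; $\mathcal C_{ns}=\left\{\begin{pmatrix}a&\varepsilon b\\b&a\end{pmatrix}:(a,b)\ne(0,0)\right\}$; and $\mathcal C_{ns}^+=\mathcal C_{ns}\cup\begin{pmatrix}1&0\\0&-1\end{pmatrix}\mathcal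 C_{ns}$. Below, "conjugate" means conjugate in $\mathrm{GL}_2(\mathbb F_\ell)$. If $\ell\nmid|G|$, say that $G$ is of type - Cs if $G$ is conjugate to a subgroup of $\mathcal C_s$; - Cn if $G$ is conjugate to a subgroup of $\mathcal C_{ns}$, but not of $\mathcal C_s$; - Ns if $G$ is conjugate to a subgroup of $\mathcal C_s^+$, but not of $\mathcal C_s$ or $\mathcal C_{ns}$; - Nn if $G$ is conjugate to a subgroup of $\mathcal C_{ns}^+$, but not of $\mathcal C_s^+$ or $\mathcal C_{ns}$; - A4, S4 or A5 if $\overline G$ is isomorphic to the alternating group $A_4$, the symmetric group $S_4$ or the alternating group $A_5$, respectively. If $\ell\mid|G|$, say that $G$ is of type - B if $G$ is conjugate to a subgroup of $\mathcal B$, but not of $\mathcal C_s$; - PSL if $\overline G=\mathrm{PSL}_2(\mathbb F_\ell)$; - PGL if $\overline G=\mathrm{PGL}_2(\mathbb F_\ell)$. Then the following hold. 1. $\mathcal F(G)=1$ if $G$ is of type Cs or B; $\mathcal F(G)=\frac1{|\overline G|}$ if $G$ is of type Cn; $\mathcal F(G)=\frac{\ell+3}{2(\ell+1)}$ if $G$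 is of type PSL; and $\mathcal F(G)=\frac{\ell+2}{2(\ell+1)}$ if $G$ is of type PGL. 2. $\mathcal F(G)$ belongs to - $\left\{\frac12,\frac34,1\right\}$ if $G$ is of type Ns; - $\left\{\frac1{|\overline G|},\ \frac14+\frac1{|\overline G|},\ \frac12+\frac1{|\overline G|}\right\}$ if $G$ is of type Nn; - $\left\{\frac1{12},\frac13,\frac34,1\right\}$ if $G$ is of type A4; - $\left\{\frac1{24},\frac7{24},\frac38,\frac5{12},\frac58,\frac23,\frac34,1\right\}$ if $G$ is of type S4; - $\left\{\frac1{60},\frac4{15},\frac7{20},\frac5{12},\frac35,\frac23,\frac34,1\right\}$ if $G$ is of type A5. 3. If $G$ is of type Cn, Nn, PSL or PGL, then $\mathcal F(G)\le\frac34$. 4. For every subgroup $G\subseteq\mathrm{GL}_2(\mathbb F_\ell)$: if $\mathcal F(G)\ne1$, then $\mathcal F(G)\le\frac34$. -/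

import Mathlib

namespace EigenProportion

/-- The group `GL₂(𝔽_ℓ)`. -/
abbrev GL2 (ℓ : ℕ) : Type := Matrix.GeneralLinearGroup (Fin 2) (ZMod ℓ)

/-- The group `PGL₂(𝔽_ℓ)`, the quotient of `GL₂(𝔽_ℓ)` by its center. -/
abbrev PGL2 (ℓ : ℕ) : Type := Matrix.ProjGenLinGroup (Fin 2) (ZMod ℓ)

/-- `PSL₂(𝔽_ℓ)` as a subgroup of `PGL₂(𝔽_ℓ)`: the image of `SL₂(𝔽_ℓ)`. -/
def PSL2 (ℓ : ℕ) : Subgroup (PGL2 ℓ) :=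
  (Matrix.SpecialLinearGroup.toGL :
    Matrix.SpecialLinearGroup (Fin 2) (ZMod ℓ) →* GL2 ℓ).range.map Matrix.ProjGenLinGroup.mk

/-- The image `Ḡ` of a subgroup `G ⊆ GL₂(𝔽_ℓ)` in `PGL₂(𝔽_ℓ)`. -/
def projImage {ℓ : ℕ} (G : Subgroup (GL2 ℓ)) : Subgroup (PGL2 ℓ) :=
  G.map Matrix.ProjGenLinGroup.mk

/-- The Borel subgroup (as a set): invertible upper triangular matrices. -/
def borel (ℓ : ℕ) : Set (GL2 ℓ) :=
  {γ | ∃ a b d : ZMod ℓ, (γ : Matrix (Fin 2) (Fin 2) (ZMod ℓ)) = !![a, b; 0, d]}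

/-- The split Cartan subgroup (as a set): invertible diagonal matrices. -/
def splitCartan (ℓ : ℕ) : Set (GL2 ℓ) :=
  {γ | ∃ a b : ZMod ℓ, (γ : Matrix (Fin 2) (Fin 2) (ZMod ℓ)) = !![a, 0; 0, b]}

/-- The normalizer of the split Cartan subgroup (as a set): the split Cartan subgroup together
with its translate by `!![0, 1; 1, 0]`. -/
def splitCartanNormalizer (ℓ : ℕ) : Set (GL2 ℓ) :=
  splitCartan ℓ ∪ {γ | ∃ δ ∈ splitCartan ℓ,
    (γ : Matrix (Fin 2) (Fin 2) (ZMod ℓ)) =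
      !![0, 1; 1, 0] * (δ : Matrix (Fin 2) (Fin 2) (ZMod ℓ))}

/-- The non-split Cartan subgroup (as a set) attached to a non-square `ε`. -/
def nonsplitCartan (ℓ : ℕ) (ε : ZMod ℓ) : Set (GL2 ℓ) :=
  {γ | ∃ a b : ZMod ℓ, (γ : Matrix (Fin 2) (Fin 2) (ZMod ℓ)) = !![a, ε * b; b, a]}

/-- The normalizer of the non-split Cartan subgroup (as a set): the non-split Cartan subgroup
together with its translate by `!![1, 0; 0, -1]`. -/
def nonsplitCartanNormalizer (ℓ : ℕ) (ε : ZMod ℓ) : Set (GL2 ℓ) :=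
  nonsplitCartan ℓ ε ∪ {γ | ∃ δ ∈ nonsplitCartan ℓ ε,
    (γ : Matrix (Fin 2) (Fin 2) (ZMod ℓ)) =
      !![1, 0; 0, -1] * (δ : Matrix (Fin 2) (Fin 2) (ZMod ℓ))}

/-- `G` is conjugate in `GL₂(𝔽_ℓ)` to a subgroup of `H`. -/
def ConjInto {ℓ : ℕ} (G : Subgroup (GL2 ℓ)) (H : Set (GL2 ℓ)) : Prop :=
  ∃ g : GL2 ℓ, ∀ γ ∈ G, g * γ * g⁻¹ ∈ H

/-- The types in Dickson's classification of subgroups of `GL₂(𝔽_ℓ)`. -/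
inductive DicksonType : Type
  | Cs | Cn | Ns | Nn | A4 | S4 | A5 | B | PSL | PGL

/-- `HasType ε G t`: the subgroup `G` of `GL₂(𝔽_ℓ)` has type `t` in Dickson's classification
(where `ε` is the non-square used to write down the non-split Cartan subgroup). The first seven
types are for groups of order prime to `ℓ`, the last three for groups of order divisible by `ℓ`. -/
def HasType {ℓ : ℕ} (ε : ZMod ℓ) (G : Subgroup (GL2 ℓ)) : DicksonType → Prop
  | .Cs => ¬ ℓ ∣ Nat.card G ∧ ConjInto G (splitCartan ℓ)
  | .Cn => ¬ ℓ ∣ Nat.card G ∧ ConjInto G (nonsplitCartan ℓ ε) ∧ ¬ ConjInto G (splitCartan ℓ)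
  | .Ns => ¬ ℓ ∣ Nat.card G ∧ ConjInto G (splitCartanNormalizer ℓ) ∧
      ¬ ConjInto G (splitCartan ℓ) ∧ ¬ ConjInto G (nonsplitCartan ℓ ε)
  | .Nn => ¬ ℓ ∣ Nat.card G ∧ ConjInto G (nonsplitCartanNormalizer ℓ ε) ∧
      ¬ ConjInto G (splitCartanNormalizer ℓ) ∧ ¬ ConjInto G (nonsplitCartan ℓ ε)
  | .A4 => ¬ ℓ ∣ Nat.card G ∧ Nonempty (projImage G ≃* alternatingGroup (Fin 4))
  | .S4 => ¬ ℓ ∣ Nat.card G ∧ Nonempty (projImage G ≃* Equiv.Perm (Fin 4))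
  | .A5 => ¬ ℓ ∣ Nat.card G ∧ Nonempty (projImage G ≃* alternatingGroup (Fin 5))
  | .B => ℓ ∣ Nat.card G ∧ ConjInto G (borel ℓ) ∧ ¬ ConjInto G (splitCartan ℓ)
  | .PSL => ℓ ∣ Nat.card G ∧ projImage G = PSL2 ℓ
  | .PGL => ℓ ∣ Nat.card G ∧ projImage G = ⊤

/-- The set of matrices in `GL₂(𝔽_ℓ)` having some eigenvalue in `𝔽_ℓ`. -/
def eigenSet (ℓ : ℕ) : Set (GL2 ℓ) :=
  {γ | ∃ c : ZMod ℓ, Module.End.HasEigenvalue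
    (Matrix.toLin' (γ : Matrix (Fin 2) (Fin 2) (ZMod ℓ))) c}

/-- The proportion `F(G)` of elements of `G` that have some eigenvalue in `𝔽_ℓ`. -/
noncomputable def eigenProportion {ℓ : ℕ} (G : Subgroup (GL2 ℓ)) : ℚ :=
  (Nat.card ↥((G : Set (GL2 ℓ)) ∩ eigenSet ℓ) : ℚ) / (Nat.card G : ℚ)

end EigenProportion

open EigenProportion

/-! In odd characteristic a 2 × 2 matrix has an eigenvalue exactly when its discriminant tr² − 4 det
is a square. Multiplying by a scalar c multiplies the discriminant by c², so the condition descends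
to PGL₂ and F(G) depends only on Ḡ (`eigenProportion_eq_proj`).

Upper triangular matrices have discriminant (a − d)²; in the non-split Cartan it is 4εb², a square
only for scalars. The non-trivial coset of either Cartan in its normalizer consists of trace-zero
matrices, for which the condition says that −det is a square. Since classes modulo squares multiply,
this holds on none, half or all of that coset of G (`card_filter_neg_det_isSquare`). For PSL and PGL
one may take G = SL₂ or GL₂ and count matrices of non-square discriminant. For A₄, S₄, A₅ the
eigenvalue condition is stable under conjugation, inversion and squaring when h² ≠ 1
(`IsEigenLike`), so only a few independent choices remain.

For the bound 3/4, suppose that g ∈ G has no eigenvalue. Its centralizer H in G is abelian, and the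
non-scalar elements of H, at least half of H, have no eigenvalue either. A conjugacy class contains
at most two of them, since trace and determinant leave only h and tr h − h. Hence their conjugates
fill at least a quarter of G (`eigenProportion_le_of_ne_one`). Types Cn and Nn then only require
F(G) ≠ 1. -/

namespace EigenProportion

open Matrix

/-! ### Discriminants and centralizers of 2 × 2 matrices over a field. -/

section Matrices

variable {K : Type*} [Field K]

/-- The discriminant of a `2 × 2` matrix in terms of its entries. -/
lemma discr_eq_entries (A : Matrix (Fin 2) (Fin 2) K) :
    A.discr = (A 0 0 - A 1 1) ^ 2 + 4 * A 0 1 * A 1 0 := by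
  rw [discr_fin_two, trace_fin_two, det_fin_two]; ring

lemma hasEigenvalue_toLin'_iff (A : Matrix (Fin 2) (Fin 2) K) (c : K) :
    Module.End.HasEigenvalue (toLin' A) c ↔ c ^ 2 - A.trace * c + A.det = 0 := by
  rw [Module.End.hasEigenvalue_iff_isRoot_charpoly, charpoly_toLin', charpoly_fin_two]
  simp

/-- Completing the square in the characteristic polynomial: a root c corresponds to the square root
2c − tr of the discriminant. -/
lemma exists_hasEigenvalue_iff (h2 : (2 : K) ≠ 0) (A : Matrix (Fin 2) (Fin 2) K) :
    (∃ c, Module.End.HasEigenvalue (toLin' A) c) ↔ IsSquare A.discr := by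
  simp only [hasEigenvalue_toLin'_iff, discr_fin_two]
  constructor
  · rintro ⟨c, hc⟩
    exact ⟨2 * c - A.trace, by linear_combination (-4) * hc⟩
  · rintro ⟨s, hs⟩
    refine ⟨(A.trace + s) / 2, ?_⟩
    field_simp
    linear_combination -hs

lemma apply_zero_one_ne_zero {A : Matrix (Fin 2) (Fin 2) K} (hA : ¬ IsSquare A.discr) :
    A 0 1 ≠ 0 := by
  intro h
  exact hA ⟨A 0 0 - A 1 1, by rw [discr_eq_entries, h]; ring⟩

/-- A matrix commuting with a matrix with non-zero upper right entry is, up to a scalar matrix,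
a multiple of it. -/
lemma entries_of_commute {A B : Matrix (Fin 2) (Fin 2) K} (hA : A 0 1 ≠ 0) (h : B * A = A * B) :
    ∃ t, B 0 1 = t * A 0 1 ∧ B 1 0 = t * A 1 0 ∧ B 0 0 - B 1 1 = t * (A 0 0 - A 1 1) := by
  have e00 := congrFun₂ h 0 0
  have e01 := congrFun₂ h 0 1
  simp only [mul_apply, Fin.sum_univ_two] at e00 e01
  refine ⟨B 0 1 / A 0 1, by field_simp, ?_, ?_⟩
  · field_simp; linear_combination -e00
  · field_simp; linear_combination e01

/-- Modulo scalars, both B and C are multiples of A, so they commute: centralizers of non-scalar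
matrices are abelian. -/
lemma commute_of_commute {A B C : Matrix (Fin 2) (Fin 2) K} (hA : A 0 1 ≠ 0)
    (hB : B * A = A * B) (hC : C * A = A * C) : B * C = C * B := by
  obtain ⟨t, h1, h2, h3⟩ := entries_of_commute hA hB
  obtain ⟨u, k1, k2, k3⟩ := entries_of_commute hA hC
  ext i j
  fin_cases i <;> fin_cases j <;>
    simp only [mul_apply, Fin.sum_univ_two, Fin.zero_eta, Fin.mk_one, Fin.isValue, h1, h2, k1, k2]
  · ring
  · linear_combination u * A 0 1 * h3 - t * A 0 1 * k3
  · linear_combination -u * A 1 0 * h3 + t * A 1 0 * k3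
  · ring

/-- Modulo scalars B is tA, so its discriminant is t² times that of A, and t ≠ 0 because B is not
scalar. -/
lemma not_isSquare_discr_of_commute {A B : Matrix (Fin 2) (Fin 2) K} (hA : ¬ IsSquare A.discr)
    (h : B * A = A * B) (hB : ∀ c, B ≠ scalar (Fin 2) c) : ¬ IsSquare B.discr := by
  obtain ⟨t, h1, h2, h3⟩ := entries_of_commute (apply_zero_one_ne_zero hA) h
  have ht : t ≠ 0 := by
    rintro rfl
    refine hB (B 0 0) ?_
    have h3 : B 1 1 = B 0 0 := by linear_combination -h3
    ext i j
    fin_cases i <;> fin_cases j <;> simp [h1, h2, h3]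
  rintro ⟨s, hs⟩
  refine hA ⟨s / t, ?_⟩
  rw [discr_eq_entries, h1, h2, h3] at hs
  rw [discr_eq_entries]
  field_simp
  linear_combination hs

/-- Commuting matrices without eigenvalues that have the same characteristic polynomial are equal
or conjugate over the quadratic extension that they generate. -/
lemma eq_or_eq_of_commute (h2 : (2 : K) ≠ 0) {A B : Matrix (Fin 2) (Fin 2) K}
    (hA : ¬ IsSquare A.discr) (h : B * A = A * B) (htr : B.trace = A.trace)
    (hdet : B.det = A.det) : B = A ∨ B = scalar (Fin 2) A.trace - A := by
  obtain ⟨t, h1, h2', h3⟩ := entries_of_commute (apply_zero_one_ne_zero hA) h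
  have hd : B.discr = A.discr := by rw [discr_fin_two, discr_fin_two, htr, hdet]
  have hne : A.discr ≠ 0 := fun h0 => hA (h0 ▸ IsSquare.zero)
  -- Equal trace and determinant give equal discriminants, while commuting gives a ratio t²; hence t
  -- = ±1.
  have hd' : (t - 1) * (t + 1) * A.discr = 0 := by
    rw [discr_eq_entries, h1, h2', h3] at hd
    rw [discr_eq_entries] at hd ⊢
    linear_combination hd
  have ht : t = 1 ∨ t = -1 := by
    rcases mul_eq_zero.mp ((mul_eq_zero.mp hd').resolve_right hne) with h | h
    · exact .inl (sub_eq_zero.mp h)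
    · exact .inr (eq_neg_of_add_eq_zero_left h)
  rw [trace_fin_two, trace_fin_two] at htr
  rcases ht with rfl | rfl
  · left
    ext i j
    fin_cases i <;> fin_cases j <;> simp only [Fin.zero_eta, Fin.mk_one, Fin.isValue]
    · exact mul_left_cancel₀ h2 (by linear_combination htr + h3)
    · simpa using h1
    · simpa using h2'
    · exact mul_left_cancel₀ h2 (by linear_combination htr - h3)
  · right
    ext i j
    fin_cases i <;> fin_cases j <;>
      simp [trace_fin_two]
    · exact mul_left_cancel₀ h2 (by linear_combination htr + h3)
    · simpa using h1
    · simpa using h2'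
    · exact mul_left_cancel₀ h2 (by linear_combination htr - h3)

end Matrices

/-! ### Stability of the eigenvalue condition under group operations. -/

section GL2

variable {ℓ : ℕ} [Fact ℓ.Prime]

lemma two_ne_zero_of_ne_two (hℓ : ℓ ≠ 2) : (2 : ZMod ℓ) ≠ 0 :=
  Ring.two_ne_zero (by rwa [ZMod.ringChar_zmod_n])

lemma mem_eigenSet_iff (hℓ : ℓ ≠ 2) (γ : GL2 ℓ) : γ ∈ eigenSet ℓ ↔ IsSquare γ.1.discr :=
  exists_hasEigenvalue_iff (two_ne_zero_of_ne_two hℓ) γ.1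

lemma mem_center_iff (γ : GL2 ℓ) :
    γ ∈ Subgroup.center (GL2 ℓ) ↔ ∃ c, γ.1 = scalar (Fin 2) c := by
  rw [GeneralLinearGroup.mem_center_iff_val_mem_range_scalar]
  simp only [Set.mem_range, eq_comm]

lemma conj_mem_eigenSet_iff (hℓ : ℓ ≠ 2) (g γ : GL2 ℓ) :
    g * γ * g⁻¹ ∈ eigenSet ℓ ↔ γ ∈ eigenSet ℓ := by
  rw [mem_eigenSet_iff hℓ, mem_eigenSet_iff hℓ]
  simp only [Units.val_mul, coe_units_inv, discr_conj]

lemma mul_center_mem_eigenSet_iff (hℓ : ℓ ≠ 2) (γ : GL2 ℓ) {z : GL2 ℓ}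
    (hz : z ∈ Subgroup.center (GL2 ℓ)) : γ * z ∈ eigenSet ℓ ↔ γ ∈ eigenSet ℓ := by
  obtain ⟨c, hc⟩ := (mem_center_iff z).mp hz
  have hc0 : c ≠ 0 := by
    rintro rfl
    exact z.ne_zero (by rw [hc, map_zero])
  rw [mem_eigenSet_iff hℓ, mem_eigenSet_iff hℓ]
  have : (γ * z).1.discr = γ.1.discr * c ^ 2 := by
    rw [Units.val_mul, hc, discr_eq_entries, discr_eq_entries]
    simp [mul_apply]
    ring
  rw [this]
  constructor
  · rintro ⟨s, hs⟩
    exact ⟨s / c, by field_simp; linear_combination hs⟩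
  · rintro ⟨s, hs⟩
    exact ⟨s * c, by rw [hs]; ring⟩

lemma center_subset_eigenSet (hℓ : ℓ ≠ 2) {γ : GL2 ℓ} (h : γ ∈ Subgroup.center (GL2 ℓ)) :
    γ ∈ eigenSet ℓ := by
  obtain ⟨c, hc⟩ := (mem_center_iff γ).mp h
  rw [mem_eigenSet_iff hℓ, hc, discr_eq_entries]
  exact ⟨0, by simp⟩

lemma inv_mem_eigenSet (hℓ : ℓ ≠ 2) {γ : GL2 ℓ} (h : γ ∈ eigenSet ℓ) : γ⁻¹ ∈ eigenSet ℓ := by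
  rw [mem_eigenSet_iff hℓ] at h ⊢
  obtain ⟨s, hs⟩ := h
  refine ⟨γ.1.det⁻¹ * s, ?_⟩
  rw [discr_eq_entries] at hs ⊢
  simp [inv_def, adjugate_fin_two, Ring.inverse_eq_inv']
  linear_combination (γ.1.det⁻¹) ^ 2 * hs

/-- If `γ²` is not a scalar matrix, then `γ` has an eigenvalue if and only if `γ²` has one. -/
lemma sq_mem_eigenSet_iff (hℓ : ℓ ≠ 2) {γ : GL2 ℓ} (h : γ ^ 2 ∉ Subgroup.center (GL2 ℓ)) :
    γ ^ 2 ∈ eigenSet ℓ ↔ γ ∈ eigenSet ℓ := by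
  -- If λ, μ are the eigenvalues, (λ² − μ²)² = (λ + μ)²(λ − μ)².
  have hd : (γ ^ 2).1.discr = γ.1.trace ^ 2 * γ.1.discr := by
    rw [discr_eq_entries, discr_eq_entries, trace_fin_two]
    simp [pow_two, mul_apply]
    ring
  have htr : γ.1.trace ≠ 0 := by
    intro h0
    -- Cayley–Hamilton: trace zero makes γ² the scalar −det γ.
    refine h ((mem_center_iff _).mpr ⟨-γ.1.det, ?_⟩)
    rw [trace_fin_two] at h0
    have h1 : γ.1 1 1 = - γ.1 0 0 := by linear_combination h0
    ext i j
    fin_cases i <;> fin_cases j <;> simp [pow_two, mul_apply, det_fin_two, h1] <;> ring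
  rw [mem_eigenSet_iff hℓ, mem_eigenSet_iff hℓ, hd]
  constructor
  · rintro ⟨s, hs⟩
    exact ⟨s / γ.1.trace, by field_simp; linear_combination hs⟩
  · rintro ⟨s, hs⟩
    exact ⟨γ.1.trace * s, by rw [hs]; ring⟩

end GL2

end EigenProportion

namespace EigenProportion

open Matrix

/-! ### Passing to the projective image and to conjugate subgroups. -/

/-- All non-empty fibres of the restriction of a homomorphism to a subgroup have the same size. -/
lemma card_inter_preimage {A B : Type*} [Group A] [Group B] (f : A →* B) (G : Subgroup A)
    (S : Set B) :
    Nat.card ↥((G : Set A) ∩ f ⁻¹' S) =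
      Nat.card ↥((G.map f : Set B) ∩ S) * Nat.card ↥(G ⊓ f.ker) := by
  rw [← Nat.card_prod]
  have hσ : ∀ x : ↥((G.map f : Set B) ∩ S), ∃ g ∈ G, f g = x := fun x => x.2.1
  choose σ hσG hσf using hσ
  symm
  refine Nat.card_eq_of_bijective (fun p : ↥((G.map f : Set B) ∩ S) × ↥(G ⊓ f.ker) =>
    (⟨σ p.1 * p.2, mul_mem (hσG _) p.2.2.1, ?_⟩ : ↥((G : Set A) ∩ f ⁻¹' S))) ⟨?_, ?_⟩
  · have : f p.2 = 1 := p.2.2.2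
    simpa [hσf, this] using p.1.2.2
  · rintro ⟨x, z, hz⟩ ⟨y, w, hw⟩ h
    have hz' : f z = 1 := hz.2
    have hw' : f w = 1 := hw.2
    have h : σ x * z = σ y * w := congrArg Subtype.val h
    have hxy : x = y := by
      have := congrArg f h
      simp only [map_mul, hσf, hz', hw', mul_one] at this
      exact Subtype.ext this
    subst hxy
    exact Prod.ext rfl (Subtype.ext (mul_left_cancel h))
  · rintro ⟨g, hg, hgS⟩
    let x : ↥((G.map f : Set B) ∩ S) := ⟨f g, ⟨g, hg, rfl⟩, hgS⟩
    refine ⟨(x, ⟨(σ x)⁻¹ * g, G.mul_mem (G.inv_mem (hσG x)) hg, ?_⟩), ?_⟩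
    · change f ((σ x)⁻¹ * g) = 1
      rw [map_mul, map_inv, hσf, inv_mul_cancel]
    · simp

variable {ℓ : ℕ}

lemma card_projImage_mul (G : Subgroup (GL2 ℓ)) :
    Nat.card G = Nat.card (projImage G) * Nat.card ↥(G ⊓ Subgroup.center (GL2 ℓ)) := by
  have := card_inter_preimage (ProjGenLinGroup.mk : GL2 ℓ →* PGL2 ℓ) G Set.univ
  rw [ProjGenLinGroup.ker_mk, Set.preimage_univ, Set.inter_univ, Set.inter_univ] at this
  exact this

/-- The conjugate `g G g⁻¹`. -/
abbrev conjSubgroup (g : GL2 ℓ) (G : Subgroup (GL2 ℓ)) : Subgroup (GL2 ℓ) :=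
  G.map (MulAut.conj g).toMonoidHom

lemma ConjInto.forall_mem_conjSubgroup {G : Subgroup (GL2 ℓ)} {H : Set (GL2 ℓ)}
    (h : ConjInto G H) : ∃ g, ∀ γ ∈ conjSubgroup g G, γ ∈ H := by
  obtain ⟨g, hg⟩ := h
  refine ⟨g, ?_⟩
  rintro _ ⟨γ, hγ, rfl⟩
  exact hg γ hγ

lemma ConjInto.of_conjSubgroup {g : GL2 ℓ} {G : Subgroup (GL2 ℓ)} {H : Set (GL2 ℓ)}
    (h : ConjInto (conjSubgroup g G) H) : ConjInto G H := by
  obtain ⟨k, hk⟩ := h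
  refine ⟨k * g, fun γ hγ => ?_⟩
  have := hk (g * γ * g⁻¹) ⟨γ, hγ, rfl⟩
  simpa [mul_assoc] using this

lemma card_projImage_conjSubgroup (g : GL2 ℓ) (G : Subgroup (GL2 ℓ)) :
    Nat.card (projImage (conjSubgroup g G)) = Nat.card (projImage G) := by
  have : projImage (conjSubgroup g G) =
      (projImage G).map (MulAut.conj (ProjGenLinGroup.mk g)).toMonoidHom := by
    rw [projImage, projImage, Subgroup.map_map, Subgroup.map_map]
    congr 1
  rw [this]
  exact (Nat.card_congr ((projImage G).equivMapOfInjective _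
    (MulAut.conj (ProjGenLinGroup.mk g)).injective).toEquiv).symm

variable [Fact ℓ.Prime]

lemma eigenProportion_eq_one_iff (G : Subgroup (GL2 ℓ)) :
    eigenProportion G = 1 ↔ ∀ γ ∈ G, γ ∈ eigenSet ℓ := by
  have hpos : (Nat.card G : ℚ) ≠ 0 := by exact_mod_cast Nat.card_pos.ne'
  rw [eigenProportion, div_eq_one_iff_eq hpos, Nat.cast_inj, Nat.card_coe_set_eq]
  have : Nat.card G = (G : Set (GL2 ℓ)).ncard := rfl
  rw [this]
  constructor
  · intro h γ hγ
    have := Set.eq_of_subset_of_ncard_le Set.inter_subset_left h.ge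
    exact (this.symm ▸ hγ : γ ∈ (G : Set (GL2 ℓ)) ∩ eigenSet ℓ).2
  · intro h
    rw [Set.inter_eq_left.mpr h]

/-- The image of the set of matrices with an eigenvalue in `PGL₂(𝔽_ℓ)`. -/
def projEigenSet (ℓ : ℕ) : Set (PGL2 ℓ) := ProjGenLinGroup.mk '' eigenSet ℓ

lemma mk_mem_projEigenSet_iff (hℓ : ℓ ≠ 2) (γ : GL2 ℓ) :
    ProjGenLinGroup.mk γ ∈ projEigenSet ℓ ↔ γ ∈ eigenSet ℓ := by
  refine ⟨?_, fun h => ⟨γ, h, rfl⟩⟩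
  rintro ⟨δ, hδ, h⟩
  obtain ⟨z, hz, rfl⟩ := ProjGenLinGroup.mk_eq_mk_iff'.mp h
  exact (mul_center_mem_eigenSet_iff hℓ δ hz).mpr hδ

/-- The proportion `F(G)` only depends on the image of `G` in `PGL₂(𝔽_ℓ)`. -/
lemma eigenProportion_eq_proj (hℓ : ℓ ≠ 2) (G : Subgroup (GL2 ℓ)) :
    eigenProportion G = (Nat.card ↥((projImage G : Set (PGL2 ℓ)) ∩ projEigenSet ℓ) : ℚ) /
      (Nat.card (projImage G) : ℚ) := by
  have h1 := card_inter_preimage (ProjGenLinGroup.mk : GL2 ℓ →* PGL2 ℓ) G (projEigenSet ℓ)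
  have h2 : (ProjGenLinGroup.mk : GL2 ℓ →* PGL2 ℓ) ⁻¹' projEigenSet ℓ = eigenSet ℓ :=
    Set.ext (mk_mem_projEigenSet_iff hℓ)
  rw [h2, ProjGenLinGroup.ker_mk] at h1
  have hpos : (Nat.card ↥(G ⊓ Subgroup.center (GL2 ℓ)) : ℚ) ≠ 0 := by
    exact_mod_cast Nat.card_pos.ne'
  rw [eigenProportion, h1, card_projImage_mul G]
  push_cast
  exact mul_div_mul_right _ _ hpos

lemma eigenProportion_conjSubgroup (hℓ : ℓ ≠ 2) (g : GL2 ℓ) (G : Subgroup (GL2 ℓ)) :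
    eigenProportion (conjSubgroup g G) = eigenProportion G := by
  have h := card_inter_preimage (MulAut.conj g).toMonoidHom G
  have hker : (MulAut.conj g).toMonoidHom.ker = ⊥ :=
    (MonoidHom.ker_eq_bot_iff _).mpr (MulAut.conj g).injective
  have hpre : (MulAut.conj g).toMonoidHom ⁻¹' eigenSet ℓ = eigenSet ℓ :=
    Set.ext (conj_mem_eigenSet_iff hℓ g)
  simp only [hker, inf_bot_eq, Subgroup.card_bot, mul_one] at h
  have h1 := h (eigenSet ℓ)
  have h2 := h Set.univ
  rw [hpre] at h1
  rw [Set.preimage_univ, Set.inter_univ, Set.inter_univ] at h2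
  have h2 : Nat.card G = Nat.card (conjSubgroup g G) := h2
  rw [eigenProportion, eigenProportion, h1, h2]

/-! ### The gap between 3/4 and 1. -/

/-- If some element of `G` has no eigenvalue, at least a quarter of the elements has none. -/
theorem eigenProportion_le_of_ne_one (hℓ : ℓ ≠ 2) (G : Subgroup (GL2 ℓ))
    (hG : eigenProportion G ≠ 1) : eigenProportion G ≤ 3 / 4 := by
  classical
  rw [Ne, eigenProportion_eq_one_iff] at hG
  push Not at hG
  obtain ⟨g, hgG, hg⟩ := hG
  have hg' : ¬ IsSquare g.1.discr := fun h => hg ((mem_eigenSet_iff hℓ g).mpr h)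
  let H : Subgroup (GL2 ℓ) := G ⊓ Subgroup.centralizer {g}
  let Z : Subgroup (GL2 ℓ) := G ⊓ Subgroup.center (GL2 ℓ)
  have hH : ∀ x, x ∈ H ↔ x ∈ G ∧ x * g = g * x := fun x => by
    simp only [H, Subgroup.mem_inf, Subgroup.mem_centralizer_singleton_iff]
  have hZH : Z ≤ H := inf_le_inf_left _ (Subgroup.center_le_centralizer _)
  have hgZ : g ∉ Z := fun h => hg (center_subset_eigenSet hℓ h.2)
  have hgH : g ∈ H := (hH g).mpr ⟨hgG, rfl⟩
  -- Z is a proper subgroup of H, as g lies in H but is not scalar.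
  have hcardZ : 2 * Nat.card Z ≤ Nat.card H := by
    obtain ⟨k, hk⟩ := Subgroup.card_dvd_of_le hZH
    have h0 : 0 < Nat.card H := Nat.card_pos
    have : k ≠ 1 := by
      rintro rfl
      rw [mul_one] at hk
      exact hgZ (Subgroup.eq_of_le_of_card_ge hZH hk.le ▸ hgH)
    have : k ≠ 0 := by
      rintro rfl
      omega
    have : 2 ≤ k := by omega
    rw [hk, mul_comm]
    gcongr
  have hdisc : ∀ h ∈ H, h ∉ Z → ¬ IsSquare h.1.discr := fun h hh hhZ =>
    not_isSquare_discr_of_commute hg' (congrArg Units.val ((hH h).mp hh).2)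
      fun c hc => hhZ ⟨((hH h).mp hh).1, (mem_center_iff h).mpr ⟨c, hc⟩⟩
  let FG : Finset (GL2 ℓ) := {x | x ∈ G}
  let FH : Finset (GL2 ℓ) := {x | x ∈ H}
  let FZ : Finset (GL2 ℓ) := {x | x ∈ Z}
  let D : Finset (GL2 ℓ) := {x | x ∈ G ∧ x ∉ eigenSet ℓ}
  let E : Finset (GL2 ℓ) := {x | x ∈ G ∧ x ∈ eigenSet ℓ}
  have cG : Nat.card G = FG.card := Nat.subtype_card _ (by simp [FG])
  have cH : Nat.card H = FH.card := Nat.subtype_card _ (by simp [FH])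
  have cZ : Nat.card Z = FZ.card := Nat.subtype_card _ (by simp [FZ])
  have cE : Nat.card ↥((G : Set (GL2 ℓ)) ∩ eigenSet ℓ) = E.card :=
    Nat.subtype_card _ (by simp [E])
  have cED : E.card + D.card = FG.card := by
    rw [← Finset.card_filter_add_card_filter_not (s := FG) (· ∈ eigenSet ℓ),
      Finset.filter_filter, Finset.filter_filter]
  -- Double counting for the map (x, h) ↦ x h x⁻¹ from G × (H \ Z) to D: a fibre has at most two
  -- second coordinates, each with at most |H| first coordinates.
  have hfib : ∀ d ∈ D, (((FG ×ˢ (FH \ FZ)).filter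
      fun p => p.1 * p.2 * p.1⁻¹ = d).card ≤ 2 * FH.card) := by
    intro d _
    set T := (FG ×ˢ (FH \ FZ)).filter fun p => p.1 * p.2 * p.1⁻¹ = d with hT
    have memT : ∀ p, p ∈ T ↔ p.1 ∈ G ∧ p.2 ∈ H ∧ p.2 ∉ Z ∧ p.1 * p.2 * p.1⁻¹ = d := by
      intro p; simp [hT, FG, FH, FZ, and_assoc]
    have hT1 : T.card ≤ FH.card * (T.image Prod.snd).card := by
      refine Finset.card_le_mul_card_image _ _ fun h hh => ?_
      obtain ⟨⟨x₀, h₀⟩, hx₀, rfl⟩ := Finset.mem_image.mp hh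
      obtain ⟨hx₀G, hH₀, hZ₀, rfl⟩ := (memT _).mp hx₀
      dsimp only at hx₀G hH₀ hZ₀ ⊢
      -- For fixed h, two conjugators differ by an element commuting with h. It then commutes with g
      -- too, since both it and g lie in the abelian centralizer of h.
      refine Finset.card_le_card_of_injOn (fun p => x₀⁻¹ * p.1) ?_ ?_
      · rintro ⟨x, h⟩ hx
        obtain ⟨hx, hh⟩ := Finset.mem_filter.mp hx
        obtain ⟨hxG, -, -, hxd⟩ := (memT _).mp hx
        dsimp only at hh hxG hxd ⊢
        subst hh
        have hc : (x₀⁻¹ * x) * h = h * (x₀⁻¹ * x) := by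
          have := congrArg (fun y => x₀⁻¹ * y * x) hxd
          simpa [mul_assoc] using this
        simp only [FH, Finset.coe_filter, Finset.mem_univ, true_and, Set.mem_ofPred_eq, hH]
        refine ⟨mul_mem (inv_mem hx₀G) hxG, Units.ext ?_⟩
        exact commute_of_commute (apply_zero_one_ne_zero (hdisc h hH₀ hZ₀))
          (congrArg Units.val hc) (congrArg Units.val ((hH h).mp hH₀).2.symm)
      · rintro ⟨x, h⟩ hx ⟨y, k⟩ hy hxy
        have e1 := (Finset.mem_filter.mp hx).2
        have e2 := (Finset.mem_filter.mp hy).2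
        exact Prod.ext (mul_left_cancel hxy) (e1.trans e2.symm)
    have hT2 : (T.image Prod.snd).card ≤ 2 := by
      rcases (T.image Prod.snd).eq_empty_or_nonempty with h0 | ⟨h₀, hh₀⟩
      · simp [h0]
      obtain ⟨⟨x₀, h₀⟩, hx₀, rfl⟩ := Finset.mem_image.mp hh₀
      obtain ⟨hx₀G, hH₀, hZ₀, hd₀⟩ := (memT _).mp hx₀
      dsimp only at hx₀G hH₀ hZ₀ hd₀
      rw [← Finset.card_image_of_injective _ Units.val_injective]
      -- All these second coordinates are conjugate and lie in the abelian group H, so each is h₀ or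
      -- tr h₀ − h₀.
      refine (Finset.card_le_card (t := {h₀.1, scalar (Fin 2) h₀.1.trace - h₀.1}) ?_).trans
        Finset.card_le_two
      intro m hm
      obtain ⟨h, hh, rfl⟩ := Finset.mem_image.mp hm
      obtain ⟨⟨x, h⟩, hx, rfl⟩ := Finset.mem_image.mp hh
      obtain ⟨hxG, hhH, hhZ, hxd⟩ := (memT _).mp hx
      dsimp only at hxG hhH hhZ hxd ⊢
      have hconj : h = (x⁻¹ * x₀) * h₀ * (x⁻¹ * x₀)⁻¹ := by
        have := congrArg (fun y => x⁻¹ * y * x) (hxd.trans hd₀.symm)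
        simpa [mul_assoc] using this
      rw [Finset.mem_insert, Finset.mem_singleton]
      refine eq_or_eq_of_commute (two_ne_zero_of_ne_two hℓ) (hdisc h₀ hH₀ hZ₀) ?_ ?_ ?_
      · exact commute_of_commute (apply_zero_one_ne_zero hg')
          (congrArg Units.val ((hH h).mp hhH).2) (congrArg Units.val ((hH h₀).mp hH₀).2)
      · rw [hconj, Units.val_mul, Units.val_mul, trace_units_conj]
      · rw [hconj, Units.val_mul, Units.val_mul, det_units_conj]
    calc T.card ≤ FH.card * (T.image Prod.snd).card := hT1
      _ ≤ FH.card * 2 := by gcongr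
      _ = 2 * FH.card := mul_comm _ _
  have hcount : FG.card * (FH \ FZ).card ≤ 2 * FH.card * D.card := by
    rw [← Finset.card_product]
    refine Finset.card_le_mul_card_image_of_maps_to
      (f := fun p : GL2 ℓ × GL2 ℓ => p.1 * p.2 * p.1⁻¹) ?_ _ hfib
    rintro ⟨x, h⟩ hx
    obtain ⟨hxG, hhH, hhZ⟩ : x ∈ G ∧ h ∈ H ∧ h ∉ Z := by simpa [FG, FH, FZ] using hx
    refine Finset.mem_filter.mpr ⟨Finset.mem_univ _,
      mul_mem (mul_mem hxG ((hH h).mp hhH).1) (inv_mem hxG), ?_⟩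
    rw [conj_mem_eigenSet_iff hℓ, mem_eigenSet_iff hℓ]
    exact hdisc h hhH hhZ
  have hsub : FZ ⊆ FH := fun x hx => by
    simp only [FZ, FH, Finset.mem_filter, Finset.mem_univ, true_and] at hx ⊢
    exact hZH hx
  have hsd : FH.card ≤ 2 * (FH \ FZ).card := by
    have := Finset.card_sdiff_add_card_eq_card hsub
    omega
  have hHpos : 0 < FH.card := cH ▸ Nat.card_pos
  have hGpos : (0 : ℚ) < FG.card := by exact_mod_cast (cG ▸ Nat.card_pos : 0 < FG.card)
  -- Combines |G|·|H \ Z| ≤ 2|H|·|D| with |H| ≤ 2|H \ Z|.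
  have hquarter : FG.card ≤ 4 * D.card := by
    refine Nat.le_of_mul_le_mul_left ?_ hHpos
    nlinarith
  have hq : (FG.card : ℚ) ≤ 4 * D.card := by exact_mod_cast hquarter
  have hs : (E.card : ℚ) + D.card = FG.card := by exact_mod_cast cED
  rw [eigenProportion, cE, cG, div_le_iff₀ hGpos]
  linarith

end EigenProportion

namespace EigenProportion

open Matrix

/-! ### Borel and Cartan subgroups and normalizers of Cartans. -/

variable {ℓ : ℕ} [Fact ℓ.Prime]

lemma isSquare_mul_iff_of_not_isSquare {a b : ZMod ℓ} (hb : ¬ IsSquare b) (ha : a ≠ 0) :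
    IsSquare (a * b) ↔ ¬ IsSquare a := by
  have hb0 : b ≠ 0 := fun h => hb (h ▸ IsSquare.zero)
  constructor
  · rintro ⟨s, hs⟩ ⟨t, ht⟩
    have ht0 : t ≠ 0 := by
      rintro rfl
      exact ha (by rw [ht, mul_zero])
    refine hb ⟨s / t, ?_⟩
    field_simp
    rw [pow_two, ← ht, pow_two, ← hs, mul_comm]
  · intro h
    rw [← quadraticChar_one_iff_isSquare (mul_ne_zero ha hb0), map_mul,
      quadraticChar_neg_one_iff_not_isSquare.mpr h,
      quadraticChar_neg_one_iff_not_isSquare.mpr hb]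
    norm_num

lemma isSquare_mul_iff_of_isSquare {a b : ZMod ℓ} (hb : IsSquare b) (hb0 : b ≠ 0) :
    IsSquare (a * b) ↔ IsSquare a := by
  obtain ⟨t, rfl⟩ := hb
  have ht : t ≠ 0 := left_ne_zero_of_mul hb0
  refine ⟨?_, fun h => h.mul ⟨t, rfl⟩⟩
  rintro ⟨s, hs⟩
  exact ⟨s / t, by field_simp; linear_combination hs⟩

/-- Let `P` define a subgroup of index two of `G`. Then the elements outside this subgroup
make up half of `G`, and those among them with `-det` a square make up
none, a quarter or half of `G`. -/
lemma card_filter_neg_det_isSquare (G : Subgroup (GL2 ℓ)) (P : GL2 ℓ → Prop)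
    (hP : ∀ x ∈ G, ∀ y ∈ G, (P (x * y) ↔ (P x ↔ P y))) {g : GL2 ℓ} (hg : g ∈ G) (hgP : ¬ P g) :
    2 * {x | x ∈ G ∧ P x}.ncard = Nat.card G ∧
    (4 * {x | x ∈ G ∧ ¬ P x ∧ IsSquare (-x.1.det)}.ncard = 0 ∨
      4 * {x | x ∈ G ∧ ¬ P x ∧ IsSquare (-x.1.det)}.ncard = Nat.card G ∨
      4 * {x | x ∈ G ∧ ¬ P x ∧ IsSquare (-x.1.det)}.ncard = 2 * Nat.card G) := by
  have hcard : {x | x ∈ G ∧ P x}.ncard + {x | x ∈ G ∧ ¬ P x}.ncard = Nat.card G := by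
    rw [← Set.ncard_union_eq]
    · have : Nat.card G = (G : Set (GL2 ℓ)).ncard := rfl
      rw [this]
      congr 1
      ext x
      simp only [Set.mem_union, Set.mem_ofPred_eq, SetLike.mem_coe]
      tauto
    · rw [Set.disjoint_left]
      rintro x ⟨-, h⟩ ⟨-, h'⟩
      exact h' h
  have hhalf : {x | x ∈ G ∧ ¬ P x}.ncard = {x | x ∈ G ∧ P x}.ncard := by
    rw [← Set.ncard_image_of_injective {x | x ∈ G ∧ P x} (mul_left_injective g)]
    congr 1
    ext x
    constructor
    · rintro ⟨hx, hxP⟩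
      have hx' : x * g⁻¹ ∈ G := G.mul_mem hx (G.inv_mem hg)
      refine ⟨x * g⁻¹, ⟨hx', ?_⟩, by simp⟩
      have := hP _ hx' _ hg
      rw [inv_mul_cancel_right] at this
      tauto
    · rintro ⟨y, ⟨hy, hyP⟩, rfl⟩
      have := hP _ hy _ hg
      exact ⟨G.mul_mem hy hg, by tauto⟩
  refine ⟨by omega, ?_⟩
  have hneg : ∀ x : GL2 ℓ, -x.1.det ≠ 0 := fun x =>
    neg_ne_zero.mpr (GeneralLinearGroup.det_ne_zero x)
  -- If the index-two subgroup contains k of non-square determinant, translation by k exchanges the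
  -- two square classes of −det on the other coset. Otherwise −det has a constant square class
  -- there.
  by_cases hk : ∃ k ∈ G, P k ∧ ¬ IsSquare k.1.det
  · obtain ⟨k, hkG, hkP, hk⟩ := hk
    right; left
    have hsum : {x | x ∈ G ∧ ¬ P x ∧ IsSquare (-x.1.det)}.ncard +
        {x | x ∈ G ∧ ¬ P x ∧ ¬ IsSquare (-x.1.det)}.ncard = {x | x ∈ G ∧ ¬ P x}.ncard := by
      rw [← Set.ncard_union_eq]
      · congr 1
        ext x
        simp only [Set.mem_union, Set.mem_ofPred_eq]
        tauto
      · rw [Set.disjoint_left]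
        rintro x ⟨-, -, h⟩ ⟨-, -, h'⟩
        exact h' h
    have hswap : {x | x ∈ G ∧ ¬ P x ∧ ¬ IsSquare (-x.1.det)}.ncard =
        {x | x ∈ G ∧ ¬ P x ∧ IsSquare (-x.1.det)}.ncard := by
      have key : ∀ x ∈ G, (¬ P (x * k) ∧ IsSquare (-(x * k).1.det)) ↔
          (¬ P x ∧ ¬ IsSquare (-x.1.det)) := by
        intro x hx
        have h1 := hP x hx k hkG
        have h2 : IsSquare (-(x * k).1.det) ↔ ¬ IsSquare (-x.1.det) := by
          rw [Units.val_mul, det_mul, ← neg_mul]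
          exact isSquare_mul_iff_of_not_isSquare hk (hneg x)
        tauto
      rw [← Set.ncard_image_of_injective {x | x ∈ G ∧ ¬ P x ∧ ¬ IsSquare (-x.1.det)}
        (mul_left_injective k)]
      congr 1
      ext x
      constructor
      · rintro ⟨y, ⟨hy, hyP⟩, rfl⟩
        exact ⟨G.mul_mem hy hkG, (key y hy).mpr hyP⟩
      · rintro ⟨hx, hxP⟩
        have hx' : x * k⁻¹ ∈ G := G.mul_mem hx (G.inv_mem hkG)
        refine ⟨x * k⁻¹, ⟨hx', (key _ hx').mp ?_⟩, by simp⟩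
        rwa [inv_mul_cancel_right]
    omega
  · push Not at hk
    by_cases hA : ∃ a ∈ G, ¬ P a ∧ IsSquare (-a.1.det)
    · obtain ⟨a, haG, haP, ha⟩ := hA
      right; right
      have : {x | x ∈ G ∧ ¬ P x ∧ IsSquare (-x.1.det)} = {x | x ∈ G ∧ ¬ P x} := by
        ext x
        refine ⟨fun h => ⟨h.1, h.2.1⟩, fun h => ⟨h.1, h.2, ?_⟩⟩
        have hx' : a⁻¹ * x ∈ G := G.mul_mem (G.inv_mem haG) h.1
        have h1 := hP _ haG _ hx'
        rw [mul_inv_cancel_left] at h1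
        have h2 := hk _ hx' (by have := h.2; tauto)
        have h3 : -x.1.det = -a.1.det * (a⁻¹ * x).1.det := by
          rw [neg_mul, ← det_mul, ← Units.val_mul, mul_inv_cancel_left]
        rw [h3]
        exact ha.mul h2
      rw [this]
      omega
    · left
      have : {x | x ∈ G ∧ ¬ P x ∧ IsSquare (-x.1.det)} = ∅ := by
        ext x
        simp only [Set.mem_ofPred_eq, Set.mem_empty_iff_false, iff_false]
        exact fun h => hA ⟨x, h⟩
      simp [this]

/-- With trace zero the discriminant is −4 det, and 4 is a non-zero square. -/
lemma mem_eigenSet_iff_of_trace_eq_zero (hℓ : ℓ ≠ 2) {γ : GL2 ℓ} (h : γ.1.trace = 0) :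
    γ ∈ eigenSet ℓ ↔ IsSquare (-γ.1.det) := by
  have h2 := two_ne_zero_of_ne_two hℓ
  rw [mem_eigenSet_iff hℓ, discr_fin_two, h,
    show (0 : ZMod ℓ) ^ 2 - 4 * γ.1.det = -γ.1.det * (2 * 2) by ring]
  exact isSquare_mul_iff_of_isSquare ⟨2, rfl⟩ (mul_ne_zero h2 h2)

lemma borel_subset_eigenSet (hℓ : ℓ ≠ 2) {γ : GL2 ℓ} (h : γ ∈ borel ℓ) : γ ∈ eigenSet ℓ := by
  obtain ⟨a, b, d, h⟩ := h
  rw [mem_eigenSet_iff hℓ, h, discr_eq_entries]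
  exact ⟨a - d, by simp; ring⟩

lemma splitCartan_subset_borel {γ : GL2 ℓ} (h : γ ∈ splitCartan ℓ) : γ ∈ borel ℓ := by
  obtain ⟨a, b, h⟩ := h
  exact ⟨a, 0, b, h⟩

lemma eigenProportion_eq_one_of_conjInto_borel (hℓ : ℓ ≠ 2) {G : Subgroup (GL2 ℓ)}
    (h : ConjInto G (borel ℓ)) : eigenProportion G = 1 := by
  obtain ⟨g, hg⟩ := h
  rw [eigenProportion_eq_one_iff]
  intro γ hγ
  exact (conj_mem_eigenSet_iff hℓ g γ).mp (borel_subset_eigenSet hℓ (hg γ hγ))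

lemma mem_center_of_mem_nonsplitCartan (hℓ : ℓ ≠ 2) {ε : ZMod ℓ} (hε : ¬ IsSquare ε) {γ : GL2 ℓ}
    (h : γ ∈ nonsplitCartan ℓ ε) (he : γ ∈ eigenSet ℓ) : γ ∈ Subgroup.center (GL2 ℓ) := by
  obtain ⟨a, b, h⟩ := h
  have h2 := two_ne_zero_of_ne_two hℓ
  rw [mem_eigenSet_iff hℓ, h, discr_eq_entries] at he
  obtain ⟨s, hs⟩ := he
  simp at hs
  have hb : b = 0 := by
    by_contra hb
    refine hε ⟨s / (2 * b), ?_⟩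
    field_simp
    linear_combination hs
  refine (mem_center_iff γ).mpr ⟨a, ?_⟩
  rw [h, hb]
  ext i j
  fin_cases i <;> fin_cases j <;> simp

lemma mem_splitCartan_of_mem_center {γ : GL2 ℓ} (h : γ ∈ Subgroup.center (GL2 ℓ)) :
    γ ∈ splitCartan ℓ := by
  obtain ⟨c, hc⟩ := (mem_center_iff γ).mp h
  refine ⟨c, c, ?_⟩
  rw [hc]
  ext i j
  fin_cases i <;> fin_cases j <;> simp

lemma card_center_div_card (G : Subgroup (GL2 ℓ)) :
    (Nat.card ↥(G ⊓ Subgroup.center (GL2 ℓ)) : ℚ) / Nat.card G =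
      1 / (Nat.card (projImage G) : ℚ) := by
  have hpos : (Nat.card ↥(G ⊓ Subgroup.center (GL2 ℓ)) : ℚ) ≠ 0 := by
    exact_mod_cast Nat.card_pos.ne'
  rw [card_projImage_mul G]
  push_cast
  field_simp

theorem eigenProportion_of_conjInto_nonsplitCartan (hℓ : ℓ ≠ 2) {ε : ZMod ℓ} (hε : ¬ IsSquare ε)
    {G : Subgroup (GL2 ℓ)} (h : ConjInto G (nonsplitCartan ℓ ε)) :
    eigenProportion G = 1 / (Nat.card (projImage G) : ℚ) := by
  obtain ⟨g, hg⟩ := h.forall_mem_conjSubgroup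
  rw [← eigenProportion_conjSubgroup hℓ g, ← card_projImage_conjSubgroup g,
    ← card_center_div_card, eigenProportion]
  have : (conjSubgroup g G : Set (GL2 ℓ)) ∩ eigenSet ℓ =
      ↑(conjSubgroup g G ⊓ Subgroup.center (GL2 ℓ)) := by
    ext γ
    exact ⟨fun h => ⟨h.1, mem_center_of_mem_nonsplitCartan hℓ hε (hg γ h.1) h.2⟩,
      fun h => ⟨h.1, center_subset_eigenSet hℓ h.2⟩⟩
  rw [this]
  rfl

lemma val_eq_of_mem_splitCartanNormalizer {γ : GL2 ℓ} (h : γ ∈ splitCartanNormalizer ℓ)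
    (hγ : γ ∉ splitCartan ℓ) : ∃ a b, γ.1 = !![0, b; a, 0] := by
  obtain ⟨δ, ⟨a, b, hδ⟩, h⟩ := h.resolve_left hγ
  exact ⟨a, b, by rw [h, hδ]; simp⟩

lemma val_eq_of_mem_nonsplitCartanNormalizer {ε : ZMod ℓ} {γ : GL2 ℓ}
    (h : γ ∈ nonsplitCartanNormalizer ℓ ε) (hγ : γ ∉ nonsplitCartan ℓ ε) :
    ∃ a b, γ.1 = !![a, ε * b; -b, -a] := by
  obtain ⟨δ, ⟨a, b, hδ⟩, h⟩ := h.resolve_left hγ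
  exact ⟨a, b, by rw [h, hδ]; simp⟩

/-- The split Cartan subgroup has index two in its normalizer. -/
lemma mul_mem_splitCartan_iff {x y : GL2 ℓ} (hx : x ∈ splitCartanNormalizer ℓ)
    (hy : y ∈ splitCartanNormalizer ℓ) :
    x * y ∈ splitCartan ℓ ↔ (x ∈ splitCartan ℓ ↔ y ∈ splitCartan ℓ) := by
  have hdet : ∀ z : GL2 ℓ, z.1.det ≠ 0 := GeneralLinearGroup.det_ne_zero
  by_cases h1 : x ∈ splitCartan ℓ <;> by_cases h2 : y ∈ splitCartan ℓ <;>
    simp only [h1, h2, iff_true, iff_false, not_true]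
  · obtain ⟨a, b, h1⟩ := h1
    obtain ⟨c, d, h2⟩ := h2
    exact ⟨a * c, b * d, by rw [Units.val_mul, h1, h2]; simp⟩
  · obtain ⟨a, b, h1⟩ := h1
    obtain ⟨c, d, h2⟩ := val_eq_of_mem_splitCartanNormalizer hy h2
    rintro ⟨e, f, h⟩
    have hz := hdet (x * y)
    have h' := congrFun₂ h 0 1
    rw [Units.val_mul, h1, h2] at h' hz
    simp at h' hz
    tauto
  · obtain ⟨a, b, h2⟩ := h2
    obtain ⟨c, d, h1⟩ := val_eq_of_mem_splitCartanNormalizer hx h1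
    rintro ⟨e, f, h⟩
    have hz := hdet (x * y)
    have h' := congrFun₂ h 0 1
    rw [Units.val_mul, h1, h2] at h' hz
    simp at h' hz
    tauto
  · obtain ⟨a, b, h1⟩ := val_eq_of_mem_splitCartanNormalizer hx h1
    obtain ⟨c, d, h2⟩ := val_eq_of_mem_splitCartanNormalizer hy h2
    exact ⟨b * c, a * d, by rw [Units.val_mul, h1, h2]; simp⟩

/-- The non-split Cartan subgroup has index two in its normalizer. -/
lemma mul_mem_nonsplitCartan_iff (hℓ : ℓ ≠ 2) {ε : ZMod ℓ} {x y : GL2 ℓ}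
    (hx : x ∈ nonsplitCartanNormalizer ℓ ε) (hy : y ∈ nonsplitCartanNormalizer ℓ ε) :
    x * y ∈ nonsplitCartan ℓ ε ↔ (x ∈ nonsplitCartan ℓ ε ↔ y ∈ nonsplitCartan ℓ ε) := by
  have h20 := two_ne_zero_of_ne_two hℓ
  -- The two cosets are disjoint: a common matrix would have c = 0 and εd² = 0, hence determinant
  -- zero.
  have htr : ∀ z : GL2 ℓ, z ∈ nonsplitCartan ℓ ε → ∀ a b, z.1 ≠ !![a, ε * b; -b, -a] := by
    rintro z ⟨c, d, hz⟩ a b h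
    have hdet := GeneralLinearGroup.det_ne_zero z
    rw [hz] at h hdet
    have e00 := congrFun₂ h 0 0
    have e10 := congrFun₂ h 1 0
    have e01 := congrFun₂ h 0 1
    have e11 := congrFun₂ h 1 1
    simp at e00 e10 e01 e11
    have hc : c = 0 := (mul_eq_zero.mp (by linear_combination e00 + e11 :
      (2 : ZMod ℓ) * c = 0)).resolve_left h20
    have hd : ε * d ^ 2 = 0 := (mul_eq_zero.mp (by
      rcases e01 with e | e
      · linear_combination d * ε * e + d * ε * e10
      · rw [e]; ring : (2 : ZMod ℓ) * (ε * d ^ 2) = 0)).resolve_left h20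
    rw [det_fin_two] at hdet
    apply hdet
    simp [hc]
    rcases mul_eq_zero.mp hd with h | h
    · simp [h]
    · right; simpa using h
  by_cases h1 : x ∈ nonsplitCartan ℓ ε <;> by_cases h2 : y ∈ nonsplitCartan ℓ ε <;>
    simp only [h1, h2, iff_true, iff_false, not_true]
  · obtain ⟨a, b, h1⟩ := h1
    obtain ⟨c, d, h2⟩ := h2
    refine ⟨a * c + ε * b * d, a * d + b * c, ?_⟩
    rw [Units.val_mul, h1, h2]
    ext i j
    fin_cases i <;> fin_cases j <;> simp <;> ring
  · obtain ⟨a, b, h1⟩ := h1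
    obtain ⟨c, d, h2⟩ := val_eq_of_mem_nonsplitCartanNormalizer hy h2
    refine fun h => htr _ h (a * c - ε * b * d) (a * d - b * c) ?_
    rw [Units.val_mul, h1, h2]
    ext i j
    fin_cases i <;> fin_cases j <;> simp <;> ring
  · obtain ⟨a, b, h2⟩ := h2
    obtain ⟨c, d, h1⟩ := val_eq_of_mem_nonsplitCartanNormalizer hx h1
    refine fun h => htr _ h (a * c + ε * b * d) (a * d + b * c) ?_
    rw [Units.val_mul, h1, h2]
    ext i j
    fin_cases i <;> fin_cases j <;> simp <;> ring
  · obtain ⟨a, b, h1⟩ := val_eq_of_mem_nonsplitCartanNormalizer hx h1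
    obtain ⟨c, d, h2⟩ := val_eq_of_mem_nonsplitCartanNormalizer hy h2
    refine ⟨a * c - ε * b * d, a * d - b * c, ?_⟩
    rw [Units.val_mul, h1, h2]
    ext i j
    fin_cases i <;> fin_cases j <;> simp <;> ring

/-- The diagonal half of the conjugated group always has eigenvalues and contributes 1/2; the other
half contributes 0, 1/4 or 1/2. -/
theorem eigenProportion_of_conjInto_splitCartanNormalizer (hℓ : ℓ ≠ 2) {G : Subgroup (GL2 ℓ)}
    (h : ConjInto G (splitCartanNormalizer ℓ)) (hn : ¬ ConjInto G (splitCartan ℓ)) :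
    eigenProportion G ∈ ({1 / 2, 3 / 4, 1} : Set ℚ) := by
  obtain ⟨g, hg⟩ := h.forall_mem_conjSubgroup
  replace hn : ¬ ConjInto (conjSubgroup g G) (splitCartan ℓ) := fun h => hn h.of_conjSubgroup
  rw [← eigenProportion_conjSubgroup hℓ g]
  generalize conjSubgroup g G = G' at hg hn ⊢
  obtain ⟨g₀, hg₀, hg₀'⟩ : ∃ γ ∈ G', γ ∉ splitCartan ℓ := by
    by_contra! hc
    exact hn ⟨1, by simpa using hc⟩
  have key := card_filter_neg_det_isSquare G' (· ∈ splitCartan ℓ)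
    (fun x hx y hy => mul_mem_splitCartan_iff (hg x hx) (hg y hy)) hg₀ hg₀'
  have hE : Nat.card ↥((G' : Set (GL2 ℓ)) ∩ eigenSet ℓ) = {x | x ∈ G' ∧ x ∈ splitCartan ℓ}.ncard +
      {x | x ∈ G' ∧ x ∉ splitCartan ℓ ∧ IsSquare (-x.1.det)}.ncard := by
    rw [Nat.card_coe_set_eq, ← Set.ncard_union_eq]
    · congr 1
      ext γ
      simp only [Set.mem_inter_iff, SetLike.mem_coe, Set.mem_union, Set.mem_ofPred_eq,
        ← and_or_left]
      refine and_congr_right fun hγ => ?_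
      by_cases hs : γ ∈ splitCartan ℓ
      · simp [hs, borel_subset_eigenSet hℓ (splitCartan_subset_borel hs)]
      · obtain ⟨a, b, hab⟩ := val_eq_of_mem_splitCartanNormalizer (hg γ hγ) hs
        rw [mem_eigenSet_iff_of_trace_eq_zero hℓ (by simp [hab, trace_fin_two])]
        simp [hs]
    · rw [Set.disjoint_left]
      rintro x ⟨-, h⟩ ⟨-, h', -⟩
      exact h' h
  have hpos : (Nat.card G' : ℚ) ≠ 0 := by exact_mod_cast Nat.card_pos.ne'
  rw [eigenProportion, hE]
  generalize {x | x ∈ G' ∧ x ∈ splitCartan ℓ}.ncard = m at *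
  generalize {x | x ∈ G' ∧ x ∉ splitCartan ℓ ∧ IsSquare (-x.1.det)}.ncard = k at *
  generalize Nat.card G' = n at *
  have h1 : (2 : ℚ) * m = n := by exact_mod_cast key.1
  simp only [Set.mem_insert_iff, Set.mem_singleton_iff, div_eq_iff hpos, Nat.cast_add]
  rcases key.2 with h | h | h
  · have h' : (4 : ℚ) * k = 0 := by exact_mod_cast h
    left; linarith
  · have h' : (4 : ℚ) * k = n := by exact_mod_cast h
    right; left; linarith
  · have h' : (4 : ℚ) * k = 2 * n := by exact_mod_cast h
    right; right; linarith

/-- Only the scalars in the Cartan half have eigenvalues, contributing 1/|Ḡ|; the other coset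
contributes 0, 1/4 or 1/2. -/
theorem eigenProportion_of_conjInto_nonsplitCartanNormalizer (hℓ : ℓ ≠ 2) {ε : ZMod ℓ}
    (hε : ¬ IsSquare ε) {G : Subgroup (GL2 ℓ)} (h : ConjInto G (nonsplitCartanNormalizer ℓ ε))
    (hn : ¬ ConjInto G (nonsplitCartan ℓ ε)) :
    eigenProportion G ∈
      ({1 / (Nat.card (projImage G) : ℚ), 1 / 4 + 1 / (Nat.card (projImage G) : ℚ),
        1 / 2 + 1 / (Nat.card (projImage G) : ℚ)} : Set ℚ) := by
  obtain ⟨g, hg⟩ := h.forall_mem_conjSubgroup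
  replace hn : ¬ ConjInto (conjSubgroup g G) (nonsplitCartan ℓ ε) := fun h => hn h.of_conjSubgroup
  rw [← eigenProportion_conjSubgroup hℓ g, ← card_projImage_conjSubgroup g]
  generalize conjSubgroup g G = G' at hg hn ⊢
  obtain ⟨g₀, hg₀, hg₀'⟩ : ∃ γ ∈ G', γ ∉ nonsplitCartan ℓ ε := by
    by_contra! hc
    exact hn ⟨1, by simpa using hc⟩
  have key := card_filter_neg_det_isSquare G' (· ∈ nonsplitCartan ℓ ε)
    (fun x hx y hy => mul_mem_nonsplitCartan_iff hℓ (hg x hx) (hg y hy)) hg₀ hg₀'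
  have hcen : ∀ x ∈ Subgroup.center (GL2 ℓ), x ∈ nonsplitCartan ℓ ε := by
    intro x hx
    obtain ⟨c, hc⟩ := (mem_center_iff x).mp hx
    refine ⟨c, 0, ?_⟩
    rw [hc]
    ext i j
    fin_cases i <;> fin_cases j <;> simp
  have hE : Nat.card ↥((G' : Set (GL2 ℓ)) ∩ eigenSet ℓ) =
      Nat.card ↥(G' ⊓ Subgroup.center (GL2 ℓ)) +
      {x | x ∈ G' ∧ x ∉ nonsplitCartan ℓ ε ∧ IsSquare (-x.1.det)}.ncard := by
    have : Nat.card ↥(G' ⊓ Subgroup.center (GL2 ℓ)) =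
      (↑(G' ⊓ Subgroup.center (GL2 ℓ)) : Set (GL2 ℓ)).ncard := rfl
    rw [this, Nat.card_coe_set_eq, ← Set.ncard_union_eq]
    · congr 1
      ext γ
      simp only [Set.mem_inter_iff, SetLike.mem_coe, Set.mem_union, Set.mem_ofPred_eq,
        Subgroup.mem_inf, ← and_or_left]
      refine and_congr_right fun hγ => ?_
      by_cases hs : γ ∈ nonsplitCartan ℓ ε
      · simp only [hs, not_true, false_and, or_false]
        exact ⟨mem_center_of_mem_nonsplitCartan hℓ hε hs, center_subset_eigenSet hℓ⟩
      · obtain ⟨a, b, hab⟩ := val_eq_of_mem_nonsplitCartanNormalizer (hg γ hγ) hs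
        rw [mem_eigenSet_iff_of_trace_eq_zero hℓ (by simp [hab, trace_fin_two])]
        simp [hs, mt (hcen γ) hs]
    · rw [Set.disjoint_left]
      rintro x h ⟨-, h', -⟩
      exact h' (hcen x h.2)
  have hpos : (Nat.card G' : ℚ) ≠ 0 := by exact_mod_cast Nat.card_pos.ne'
  rw [eigenProportion, hE, Nat.cast_add, add_div, card_center_div_card]
  generalize {x | x ∈ G' ∧ x ∉ nonsplitCartan ℓ ε ∧ IsSquare (-x.1.det)}.ncard = k at *
  have hk : (k : ℚ) / Nat.card G' = 0 ∨ (k : ℚ) / Nat.card G' = 1 / 4 ∨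
      (k : ℚ) / Nat.card G' = 1 / 2 := by
    simp only [div_eq_iff hpos]
    rcases key.2 with h | h | h
    · have h' : (4 : ℚ) * k = 0 := by exact_mod_cast h
      left; linarith
    · have h' : (4 : ℚ) * k = Nat.card G' := by exact_mod_cast h
      right; left; linarith
    · have h' : (4 : ℚ) * k = 2 * Nat.card G' := by exact_mod_cast h
      right; right; linarith
  rcases hk with h | h | h <;> rw [h]
  · left; ring
  · right; left; ring
  · right; right; exact add_comm _ _

end EigenProportion

namespace EigenProportion

open Matrix

/-! ### Counting matrices without eigenvalues in GL₂ and SL₂. -/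

variable {ℓ : ℕ} [Fact ℓ.Prime]

/-- Each t contributes 1 on the left, whether f t is zero, a non-zero square or a non-square.
Counting non-square values thus reduces to a character sum. -/
lemma two_mul_card_not_isSquare (f : ZMod ℓ → ZMod ℓ) :
    2 * (Nat.card {t // ¬ IsSquare (f t)} : ℤ) + Nat.card {t // f t = 0} +
      ∑ t, quadraticChar (ZMod ℓ) (f t) = ℓ := by
  classical
  rw [Nat.card_eq_fintype_card, Nat.card_eq_fintype_card, Fintype.card_subtype,
    Fintype.card_subtype, Finset.card_filter, Finset.card_filter]
  push_cast
  rw [Finset.mul_sum, ← Finset.sum_add_distrib, ← Finset.sum_add_distrib]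
  have : ∀ t, (2 * (if ¬ IsSquare (f t) then 1 else 0) + (if f t = 0 then 1 else 0) +
      quadraticChar (ZMod ℓ) (f t) : ℤ) = 1 := by
    intro t
    by_cases h0 : f t = 0
    · simp [h0]
    by_cases hs : IsSquare (f t)
    · simp [h0, hs, (quadraticChar_one_iff_isSquare h0).mpr hs]
    · simp [h0, hs, quadraticChar_neg_one_iff_not_isSquare.mpr hs]
  rw [Finset.sum_congr rfl fun t _ => this t]
  simp [ZMod.card]

lemma ringChar_ne_two (hℓ : ℓ ≠ 2) : ringChar (ZMod ℓ) ≠ 2 := by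
  rwa [ZMod.ringChar_zmod_n]

lemma two_mul_card_nonsquares (hℓ : ℓ ≠ 2) :
    2 * (Nat.card {t : ZMod ℓ // ¬ IsSquare t} : ℤ) = ℓ - 1 := by
  have h := two_mul_card_not_isSquare (ℓ := ℓ) id
  simp only [id, quadraticChar_sum_zero (ringChar_ne_two hℓ)] at h
  have : Nat.card {t : ZMod ℓ // t = 0} = 1 := by simp
  rw [this] at h
  push_cast at h
  linarith

/-- The affine hyperbola `s² = t² - 4` has `ℓ - 1` points. -/
lemma card_hyperbola (hℓ : ℓ ≠ 2) :
    Nat.card {p : ZMod ℓ × ZMod ℓ // p.2 ^ 2 = p.1 ^ 2 - 4} = ℓ - 1 := by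
  have h2 := two_ne_zero_of_ne_two hℓ
  have hu : Nat.card (ZMod ℓ)ˣ = ℓ - 1 := by rw [Nat.card_eq_fintype_card, ZMod.card_units]
  rw [← hu]
  symm
  -- The equation reads (t + s)/2 · (t − s)/2 = 1, so u = (t + s)/2 parametrizes the curve.
  refine Nat.card_eq_of_bijective (fun u : (ZMod ℓ)ˣ =>
    (⟨(u.1 + u.1⁻¹, u.1 - u.1⁻¹), ?_⟩ : {p : ZMod ℓ × ZMod ℓ // p.2 ^ 2 = p.1 ^ 2 - 4})) ⟨?_, ?_⟩
  · have := u.ne_zero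
    field_simp
    ring
  · intro u v h
    have h := congrArg Subtype.val h
    simp only [Prod.mk.injEq] at h
    exact Units.ext (mul_left_cancel₀ h2 (by linear_combination h.1 + h.2))
  · rintro ⟨⟨t, s⟩, h⟩
    dsimp only at h
    have hprod : (t + s) / 2 * ((t - s) / 2) = 1 := by
      field_simp
      linear_combination -h
    refine ⟨Units.mkOfMulEqOne _ _ hprod, ?_⟩
    have hinv : ((t + s) / 2)⁻¹ = (t - s) / 2 := inv_eq_of_mul_eq_one_right hprod
    simp only [Units.val_mkOfMulEqOne, hinv, Subtype.mk.injEq, Prod.mk.injEq]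
    constructor <;> field_simp <;> ring

lemma two_mul_card_traces (hℓ : ℓ ≠ 2) :
    2 * (Nat.card {t : ZMod ℓ // ¬ IsSquare (t ^ 2 - 4)} : ℤ) = ℓ - 1 := by
  classical
  have h2 := two_ne_zero_of_ne_two hℓ
  have h := two_mul_card_not_isSquare (ℓ := ℓ) fun t => t ^ 2 - 4
  have hz : Nat.card {t : ZMod ℓ // t ^ 2 - 4 = 0} = 2 := by
    have hne : (2 : ZMod ℓ) ≠ -2 := fun h => mul_ne_zero h2 h2 (by linear_combination h)
    rw [Nat.subtype_card {2, -2}, Finset.card_pair hne]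
    intro t
    rw [Finset.mem_insert, Finset.mem_singleton, sub_eq_zero,
      show (4 : ZMod ℓ) = 2 ^ 2 by norm_num, sq_eq_sq_iff_eq_or_eq_neg]
  -- χ(t² − 4) + 1 counts the s with s² = t² − 4, so the sum counts points of the hyperbola.
  have hs : ∑ t : ZMod ℓ, (quadraticChar (ZMod ℓ) (t ^ 2 - 4) + 1) = ℓ - 1 := by
    have h1 : 1 ≤ ℓ := (Fact.out : ℓ.Prime).one_le
    have hh := card_hyperbola hℓ
    zify [h1] at hh
    rw [← hh, Nat.card_congr (Equiv.subtypeProdEquivSigmaSubtype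
      fun t s : ZMod ℓ => s ^ 2 = t ^ 2 - 4), Nat.card_sigma]
    push_cast
    refine Finset.sum_congr rfl fun t _ => ?_
    rw [← quadraticChar_card_sqrts (ringChar_ne_two hℓ)]
    congr 1
    rw [Set.toFinset_card, Nat.card_eq_fintype_card]
    rfl
  rw [Finset.sum_add_distrib] at hs
  simp only [Finset.sum_const, Finset.card_univ, ZMod.card, nsmul_eq_mul, mul_one] at hs
  rw [hz] at h
  push_cast at h
  linarith

lemma card_ne_zero_zmod : Nat.card {b : ZMod ℓ // b ≠ 0} = ℓ - 1 := by
  rw [← Nat.card_congr unitsEquivNeZero, Nat.card_eq_fintype_card, ZMod.card_units]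

/-- The number of matrices without eigenvalues. -/
lemma card_not_mem_eigenSet (hℓ : ℓ ≠ 2) :
    Nat.card {γ : GL2 ℓ // γ ∉ eigenSet ℓ} =
      ℓ * ℓ * (ℓ - 1) * Nat.card {u : ZMod ℓ // ¬ IsSquare u} := by
  have h2 := two_ne_zero_of_ne_two hℓ
  have h4 : (4 : ZMod ℓ) ≠ 0 := by
    rw [show (4 : ZMod ℓ) = 2 * 2 by norm_num]; exact mul_ne_zero h2 h2
  have hcard : Nat.card (((ZMod ℓ × ZMod ℓ) × {b : ZMod ℓ // b ≠ 0}) ×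
      {u : ZMod ℓ // ¬ IsSquare u}) =
      ℓ * ℓ * (ℓ - 1) * Nat.card {u : ZMod ℓ // ¬ IsSquare u} := by
    rw [Nat.card_prod, Nat.card_prod, Nat.card_prod, card_ne_zero_zmod, Nat.card_zmod]
  rw [← hcard]
  have hd : ∀ γ : {γ : GL2 ℓ // γ ∉ eigenSet ℓ}, ¬ IsSquare γ.1.1.discr := fun γ h =>
    γ.2 ((mem_eigenSet_iff hℓ _).mpr h)
  -- Coordinates: the diagonal, the upper right entry b and the discriminant. As b ≠ 0, the
  -- discriminant recovers the lower left entry.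
  refine Nat.card_eq_of_bijective (fun γ : {γ : GL2 ℓ // γ ∉ eigenSet ℓ} =>
    (((γ.1.1 0 0, γ.1.1 1 1), ⟨γ.1.1 0 1, apply_zero_one_ne_zero (hd γ)⟩),
      ⟨γ.1.1.discr, hd γ⟩)) ⟨?_, ?_⟩
  · intro γ δ h
    simp only [Prod.mk.injEq, Subtype.mk.injEq] at h
    obtain ⟨⟨⟨h00, h11⟩, h01⟩, h⟩ := h
    have hb := apply_zero_one_ne_zero (hd δ)
    refine Subtype.ext (Units.ext ?_)
    ext i j
    fin_cases i <;> fin_cases j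
    · exact h00
    · exact h01
    · rw [discr_eq_entries, discr_eq_entries, h00, h11, h01] at h
      exact mul_left_cancel₀ (mul_ne_zero h4 hb) (add_left_cancel h)
    · exact h11
  · rintro ⟨⟨⟨x, y⟩, b, hb⟩, u, hu⟩
    have hA : (!![x, b; (u - (x - y) ^ 2) / (4 * b), y] :
        Matrix (Fin 2) (Fin 2) (ZMod ℓ)).discr = u := by
      rw [discr_eq_entries]
      simp
      field_simp
      ring
    have hdet : (!![x, b; (u - (x - y) ^ 2) / (4 * b), y] :
        Matrix (Fin 2) (Fin 2) (ZMod ℓ)).det ≠ 0 := by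
      intro h0
      rw [discr_fin_two, h0] at hA
      exact hu ⟨_, by rw [← hA, mul_zero, sub_zero, pow_two]⟩
    refine ⟨⟨GeneralLinearGroup.mkOfDetNeZero _ hdet, ?_⟩, ?_⟩
    · rw [mem_eigenSet_iff hℓ]
      exact fun h => hu (hA ▸ h)
    · simp only [Prod.mk.injEq, Subtype.mk.injEq]
      exact ⟨⟨⟨rfl, rfl⟩, rfl⟩, hA⟩

/-- The number of matrices of determinant one without eigenvalues. -/
lemma card_det_eq_one_not_mem_eigenSet (hℓ : ℓ ≠ 2) :
    Nat.card {γ : GL2 ℓ // γ.1.det = 1 ∧ γ ∉ eigenSet ℓ} =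
      ℓ * (ℓ - 1) * Nat.card {t : ZMod ℓ // ¬ IsSquare (t ^ 2 - 4)} := by
  have hcard : Nat.card ((ZMod ℓ × {b : ZMod ℓ // b ≠ 0}) ×
      {t : ZMod ℓ // ¬ IsSquare (t ^ 2 - 4)}) =
      ℓ * (ℓ - 1) * Nat.card {t : ZMod ℓ // ¬ IsSquare (t ^ 2 - 4)} := by
    rw [Nat.card_prod, Nat.card_prod, card_ne_zero_zmod, Nat.card_zmod]
  rw [← hcard]
  have hd : ∀ γ : {γ : GL2 ℓ // γ.1.det = 1 ∧ γ ∉ eigenSet ℓ}, ¬ IsSquare γ.1.1.discr :=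
    fun γ h => γ.2.2 ((mem_eigenSet_iff hℓ _).mpr h)
  have ht : ∀ γ : {γ : GL2 ℓ // γ.1.det = 1 ∧ γ ∉ eigenSet ℓ},
      ¬ IsSquare (γ.1.1.trace ^ 2 - 4) := fun γ => by
    have := hd γ
    rwa [discr_fin_two, γ.2.1, mul_one] at this
  -- Here the trace recovers the lower right entry, and det = 1 with b ≠ 0 recovers the lower left
  -- one.
  refine Nat.card_eq_of_bijective (fun γ : {γ : GL2 ℓ // γ.1.det = 1 ∧ γ ∉ eigenSet ℓ} =>
    ((γ.1.1 0 0, ⟨γ.1.1 0 1, apply_zero_one_ne_zero (hd γ)⟩),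
      ⟨γ.1.1.trace, ht γ⟩)) ⟨?_, ?_⟩
  · intro γ δ h
    simp only [Prod.mk.injEq, Subtype.mk.injEq] at h
    obtain ⟨⟨h00, h01⟩, h⟩ := h
    have hb := apply_zero_one_ne_zero (hd δ)
    have hdet : γ.1.1.det = δ.1.1.det := γ.2.1.trans δ.2.1.symm
    rw [trace_fin_two, trace_fin_two, h00] at h
    have h11 := add_left_cancel h
    refine Subtype.ext (Units.ext ?_)
    ext i j
    fin_cases i <;> fin_cases j
    · exact h00
    · exact h01
    · rw [det_fin_two, det_fin_two, h00, h11, h01] at hdet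
      exact mul_left_cancel₀ hb (sub_right_injective hdet)
    · exact h11
  · rintro ⟨⟨x, b, hb⟩, t, ht⟩
    have hdet : (!![x, b; (x * (t - x) - 1) / b, t - x] :
        Matrix (Fin 2) (Fin 2) (ZMod ℓ)).det = 1 := by
      rw [det_fin_two]
      simp
      field_simp
      ring
    have htr : (!![x, b; (x * (t - x) - 1) / b, t - x] :
        Matrix (Fin 2) (Fin 2) (ZMod ℓ)).trace = t := by
      rw [trace_fin_two]
      simp
    refine ⟨⟨GeneralLinearGroup.mkOfDetNeZero _ (hdet.symm ▸ one_ne_zero : _ ≠ (0 : ZMod ℓ)), hdet, ?_⟩, ?_⟩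
    · rw [mem_eigenSet_iff hℓ]
      intro h
      have h : IsSquare (!![x, b; (x * (t - x) - 1) / b, t - x] :
        Matrix (Fin 2) (Fin 2) (ZMod ℓ)).discr := h
      rw [discr_fin_two, hdet, htr, mul_one] at h
      exact ht h
    · simp only [Prod.mk.injEq, Subtype.mk.injEq]
      exact ⟨⟨rfl, rfl⟩, htr⟩

lemma eigenProportion_eq_one_sub (G : Subgroup (GL2 ℓ)) :
    eigenProportion G =
      1 - (Nat.card {γ : GL2 ℓ // γ ∈ G ∧ γ ∉ eigenSet ℓ} : ℚ) / Nat.card G := by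
  have hpos : (Nat.card G : ℚ) ≠ 0 := by exact_mod_cast Nat.card_pos.ne'
  have h := Set.ncard_inter_add_ncard_sdiff_eq_ncard (G : Set (GL2 ℓ)) (eigenSet ℓ)
  have h : Nat.card ↥((G : Set (GL2 ℓ)) ∩ eigenSet ℓ) +
    Nat.card {γ : GL2 ℓ // γ ∈ G ∧ γ ∉ eigenSet ℓ} = Nat.card G := h
  have h : (Nat.card ↥((G : Set (GL2 ℓ)) ∩ eigenSet ℓ) : ℚ) +
    Nat.card {γ : GL2 ℓ // γ ∈ G ∧ γ ∉ eigenSet ℓ} = Nat.card G := by exact_mod_cast h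
  rw [eigenProportion]
  field_simp
  linarith

lemma card_GL2 : (Nat.card (GL2 ℓ) : ℚ) = (ℓ ^ 2 - 1) * (ℓ ^ 2 - ℓ) := by
  have h1 : 1 ≤ ℓ := (Fact.out : ℓ.Prime).one_le
  have h := card_GL_field (𝔽 := ZMod ℓ) 2
  rw [Fin.prod_univ_two, ZMod.card] at h
  rw [h]
  have : ℓ ≤ ℓ ^ 2 := by nlinarith
  simp only [Fin.val_zero, Fin.val_one, pow_zero, pow_one]
  rw [Nat.cast_mul, Nat.cast_sub (by nlinarith), Nat.cast_sub this]
  push_cast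
  ring

lemma mem_range_toGL_iff (γ : GL2 ℓ) :
    γ ∈ (SpecialLinearGroup.toGL : SpecialLinearGroup (Fin 2) (ZMod ℓ) →* GL2 ℓ).range ↔
      γ.1.det = 1 := by
  constructor
  · rintro ⟨s, rfl⟩
    exact s.2
  · exact fun h => ⟨⟨γ.1, h⟩, Units.ext rfl⟩

lemma card_range_toGL :
    (Nat.card (SpecialLinearGroup.toGL :
      SpecialLinearGroup (Fin 2) (ZMod ℓ) →* GL2 ℓ).range : ℚ) = (ℓ ^ 2 - 1) * ℓ := by
  have hl : 1 < ℓ := (Fact.out : ℓ.Prime).one_lt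
  have hker : (SpecialLinearGroup.toGL : SpecialLinearGroup (Fin 2) (ZMod ℓ) →* GL2 ℓ).range =
      (GeneralLinearGroup.det : GL2 ℓ →* (ZMod ℓ)ˣ).ker := by
    ext γ
    rw [mem_range_toGL_iff, MonoidHom.mem_ker, Units.ext_iff]
    rfl
  have h := (GeneralLinearGroup.det : GL2 ℓ →* (ZMod ℓ)ˣ).ker.card_mul_index
  rw [Subgroup.index_ker, MonoidHom.range_eq_top.mpr GeneralLinearGroup.det_surjective,
    Subgroup.card_top, Nat.card_eq_fintype_card (α := (ZMod ℓ)ˣ), ZMod.card_units, ← hker] at h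
  have h' := congrArg (Nat.cast : ℕ → ℚ) h
  rw [card_GL2, Nat.cast_mul, Nat.cast_sub hl.le] at h'
  have hne : ((ℓ : ℚ) - 1) ≠ 0 := by
    rw [sub_ne_zero]; exact_mod_cast hl.ne'
  push_cast at h'
  refine mul_right_cancel₀ hne ?_
  rw [h']
  ring

theorem eigenProportion_top (hℓ : ℓ ≠ 2) :
    eigenProportion (⊤ : Subgroup (GL2 ℓ)) = ((ℓ : ℚ) + 2) / (2 * ((ℓ : ℚ) + 1)) := by
  have hl : 1 < ℓ := (Fact.out : ℓ.Prime).one_lt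
  have hl' : (1 : ℚ) < ℓ := by exact_mod_cast hl
  have hn : (2 : ℚ) * Nat.card {t : ZMod ℓ // ¬ IsSquare t} = ℓ - 1 := by
    exact_mod_cast two_mul_card_nonsquares hℓ
  have hc : (Nat.card {γ : GL2 ℓ // γ ∈ (⊤ : Subgroup (GL2 ℓ)) ∧ γ ∉ eigenSet ℓ} : ℚ) =
      ℓ * ℓ * (ℓ - 1) * ((ℓ - 1) / 2) := by
    simp only [Subgroup.mem_top, true_and]
    rw [card_not_mem_eigenSet hℓ, Nat.cast_mul, Nat.cast_mul, Nat.cast_sub hl.le]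
    push_cast
    linear_combination (ℓ * ℓ * ((ℓ : ℚ) - 1)) / 2 * hn
  rw [eigenProportion_eq_one_sub, hc, Subgroup.card_top, card_GL2]
  have h1 : (ℓ : ℚ) - 1 ≠ 0 := by linarith
  have h2 : (ℓ : ℚ) + 1 ≠ 0 := by linarith
  have h3 : (ℓ : ℚ) ≠ 0 := by linarith
  rw [show ((ℓ : ℚ) ^ 2 - 1) * (ℓ ^ 2 - ℓ) = (ℓ - 1) * (ℓ + 1) * (ℓ * (ℓ - 1)) by ring]
  field_simp
  ring

theorem eigenProportion_range_toGL (hℓ : ℓ ≠ 2) :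
    eigenProportion (SpecialLinearGroup.toGL :
      SpecialLinearGroup (Fin 2) (ZMod ℓ) →* GL2 ℓ).range =
        ((ℓ : ℚ) + 3) / (2 * ((ℓ : ℚ) + 1)) := by
  have hl : 1 < ℓ := (Fact.out : ℓ.Prime).one_lt
  have hl' : (1 : ℚ) < ℓ := by exact_mod_cast hl
  have hn : (2 : ℚ) * Nat.card {t : ZMod ℓ // ¬ IsSquare (t ^ 2 - 4)} = ℓ - 1 := by
    exact_mod_cast two_mul_card_traces hℓ
  have hc : (Nat.card {γ : GL2 ℓ // γ.1.det = 1 ∧ γ ∉ eigenSet ℓ} : ℚ) =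
      ℓ * (ℓ - 1) * ((ℓ - 1) / 2) := by
    rw [card_det_eq_one_not_mem_eigenSet hℓ, Nat.cast_mul, Nat.cast_mul, Nat.cast_sub hl.le]
    push_cast
    linear_combination (ℓ * ((ℓ : ℚ) - 1)) / 2 * hn
  rw [eigenProportion_eq_one_sub, card_range_toGL]
  simp only [mem_range_toGL_iff]
  rw [hc]
  have h1 : (ℓ : ℚ) - 1 ≠ 0 := by linarith
  have h2 : (ℓ : ℚ) + 1 ≠ 0 := by linarith
  have h3 : (ℓ : ℚ) ≠ 0 := by linarith
  rw [show ((ℓ : ℚ) ^ 2 - 1) * ℓ = (ℓ - 1) * (ℓ + 1) * ℓ by ring]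
  field_simp
  ring

lemma eigenProportion_congr (hℓ : ℓ ≠ 2) {G H : Subgroup (GL2 ℓ)}
    (h : projImage G = projImage H) : eigenProportion G = eigenProportion H := by
  rw [eigenProportion_eq_proj hℓ, eigenProportion_eq_proj hℓ, h]

theorem eigenProportion_of_projImage_eq_top (hℓ : ℓ ≠ 2) {G : Subgroup (GL2 ℓ)}
    (h : projImage G = ⊤) : eigenProportion G = ((ℓ : ℚ) + 2) / (2 * ((ℓ : ℚ) + 1)) := by
  rw [← eigenProportion_top hℓ]
  refine eigenProportion_congr hℓ (h.trans ?_)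
  exact (Subgroup.map_top_of_surjective _ ProjGenLinGroup.mk_surjective).symm

theorem eigenProportion_of_projImage_eq_PSL2 (hℓ : ℓ ≠ 2) {G : Subgroup (GL2 ℓ)}
    (h : projImage G = PSL2 ℓ) : eigenProportion G = ((ℓ : ℚ) + 3) / (2 * ((ℓ : ℚ) + 1)) := by
  rw [← eigenProportion_range_toGL hℓ]
  exact eigenProportion_congr hℓ h

end EigenProportion

namespace EigenProportion

/-! ### Exceptional projective images A₄, S₄ and A₅. -/

open Matrix Equiv Equiv.Perm

/-- The properties of the set of elements of a subgroup of `PGL₂(𝔽_ℓ)` with an eigenvalue that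
do not refer to matrices. -/
structure IsEigenLike {H : Type*} [Group H] (E : H → Prop) : Prop where
  one : E 1
  conj : ∀ g h, E (g * h * g⁻¹) ↔ E h
  inv : ∀ h, E h⁻¹ ↔ E h
  sq : ∀ h, h ^ 2 ≠ 1 → (E (h ^ 2) ↔ E h)

/-- A double transposition in `A₄`. -/
def alt4Double : alternatingGroup (Fin 4) :=
  ⟨swap 0 1 * swap 2 3, mem_alternatingGroup.mpr (by decide)⟩

/-- A three-cycle in `A₄`. -/
def alt4Three : alternatingGroup (Fin 4) :=
  ⟨swap 0 1 * swap 1 2, mem_alternatingGroup.mpr (by decide)⟩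

/-- The 3-cycles form two classes in A₄, exchanged by inversion, so stability under inversion merges
them. -/
lemma alt4_classes : ∀ h : alternatingGroup (Fin 4), h = 1 ∨
    (h ≠ 1 ∧ h * h = 1 ∧ ∃ g, g * alt4Double * g⁻¹ = h) ∨
    (h ≠ 1 ∧ h * h ≠ 1 ∧ ∃ g, g * alt4Three * g⁻¹ = h ∨ g * alt4Three⁻¹ * g⁻¹ = h) := by
  decide +kernel

lemma alt4_count : ∀ p q : Bool,
    ({h : alternatingGroup (Fin 4) | h = 1 ∨ (h ≠ 1 ∧ h * h = 1 ∧ p) ∨ (h ≠ 1 ∧ h * h ≠ 1 ∧ q)} :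
      Finset _).card = 1 + 3 * p.toNat + 8 * q.toNat := by
  decide +kernel

lemma IsEigenLike.card_alt4 {E : alternatingGroup (Fin 4) → Prop} (hE : IsEigenLike E) :
    (Nat.card {h // E h} : ℚ) / Nat.card (alternatingGroup (Fin 4)) ∈
      ({1 / 12, 1 / 3, 3 / 4, 1} : Set ℚ) := by
  classical
  have hcard : Nat.card (alternatingGroup (Fin 4)) = 12 := by
    rw [Nat.card_eq_fintype_card]
    decide +kernel
  have hcount := alt4_count (decide (E alt4Double)) (decide (E alt4Three))
  rw [← Nat.subtype_card (p := E) _ fun h => ?_] at hcount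
  · rw [hcount, hcard]
    by_cases hp : E alt4Double <;> by_cases hq : E alt4Three <;> simp [hp, hq] <;> norm_num
  · simp only [Finset.mem_filter, Finset.mem_univ, true_and, decide_eq_true_eq]
    rcases alt4_classes h with rfl | ⟨h1, h2, g, hg⟩ | ⟨h1, h2, g, hg⟩
    · simp [hE.one]
    · have : E h ↔ E alt4Double := by rw [← hg, hE.conj]
      simp [h1, h2, this]
    · have : E h ↔ E alt4Three := by
        rcases hg with hg | hg
        · rw [← hg, hE.conj]
        · rw [← hg, hE.conj, hE.inv]
      simp [h1, h2, this]

/-- A 4-cycle is represented through its square, a double transposition: stability under squaring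
forces both classes to behave alike, which leaves three free choices. -/
lemma perm4_classes : ∀ h : Perm (Fin 4), h = 1 ∨
    (h ≠ 1 ∧ h * h = 1 ∧ sign h = 1 ∧ ∃ g, g * (swap 0 1 * swap 2 3) * g⁻¹ = h) ∨
    (h ≠ 1 ∧ h * h = 1 ∧ sign h ≠ 1 ∧ ∃ g, g * swap 0 1 * g⁻¹ = h) ∨
    (h ≠ 1 ∧ h * h ≠ 1 ∧ sign h = 1 ∧ ∃ g, g * (swap 0 1 * swap 1 2) * g⁻¹ = h) ∨
    (h ≠ 1 ∧ h * h ≠ 1 ∧ sign h ≠ 1 ∧ ∃ g, g * (swap 0 1 * swap 2 3) * g⁻¹ = h ^ 2) := by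
  decide +kernel

lemma perm4_count : ∀ p q r : Bool,
    ({h : Perm (Fin 4) | h = 1 ∨ (h ≠ 1 ∧ h * h = 1 ∧ sign h = 1 ∧ p) ∨
      (h ≠ 1 ∧ h * h = 1 ∧ sign h ≠ 1 ∧ q) ∨ (h ≠ 1 ∧ h * h ≠ 1 ∧ sign h = 1 ∧ r) ∨
      (h ≠ 1 ∧ h * h ≠ 1 ∧ sign h ≠ 1 ∧ p)} : Finset _).card =
      1 + 9 * p.toNat + 6 * q.toNat + 8 * r.toNat := by
  decide +kernel

lemma IsEigenLike.card_perm4 {E : Perm (Fin 4) → Prop} (hE : IsEigenLike E) :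
    (Nat.card {h // E h} : ℚ) / Nat.card (Perm (Fin 4)) ∈
      ({1 / 24, 7 / 24, 3 / 8, 5 / 12, 5 / 8, 2 / 3, 3 / 4, 1} : Set ℚ) := by
  classical
  have hcard : Nat.card (Perm (Fin 4)) = 24 := by
    rw [Nat.card_eq_fintype_card]
    decide +kernel
  have hcount := perm4_count (decide (E (swap 0 1 * swap 2 3))) (decide (E (swap 0 1)))
    (decide (E (swap 0 1 * swap 1 2)))
  rw [← Nat.subtype_card (p := E) _ fun h => ?_] at hcount
  · rw [hcount, hcard]
    by_cases hp : E (swap 0 1 * swap 2 3) <;> by_cases hq : E (swap 0 1) <;>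
      by_cases hr : E (swap 0 1 * swap 1 2) <;> simp [hp, hq, hr] <;> norm_num
  · simp only [Finset.mem_filter, Finset.mem_univ, true_and, decide_eq_true_eq]
    rcases perm4_classes h with rfl | ⟨h1, h2, h3, g, hg⟩ | ⟨h1, h2, h3, g, hg⟩ |
      ⟨h1, h2, h3, g, hg⟩ | ⟨h1, h2, h3, g, hg⟩
    · simp [hE.one]
    · have : E h ↔ E (swap 0 1 * swap 2 3) := by rw [← hg, hE.conj]
      simp [h1, h2, h3, this]
    · have : E h ↔ E (swap 0 1) := by rw [← hg, hE.conj]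
      simp [h1, h2, h3, this]
    · have : E h ↔ E (swap 0 1 * swap 1 2) := by rw [← hg, hE.conj]
      simp [h1, h2, h3, this]
    · have : E h ↔ E (swap 0 1 * swap 2 3) := by
        rw [← hE.sq h (by rwa [pow_two]), ← hg, hE.conj]
      simp [h1, h2, h3, this]

/-- A double transposition in `A₅`. -/
def alt5Double : alternatingGroup (Fin 5) :=
  ⟨swap 0 1 * swap 2 3, mem_alternatingGroup.mpr (by decide)⟩

/-- A three-cycle in `A₅`. -/
def alt5Three : alternatingGroup (Fin 5) :=
  ⟨swap 0 1 * swap 1 2, mem_alternatingGroup.mpr (by decide)⟩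

/-- A five-cycle in `A₅`. -/
def alt5Five : alternatingGroup (Fin 5) :=
  ⟨swap 0 1 * swap 1 2 * swap 2 3 * swap 3 4, mem_alternatingGroup.mpr (by decide)⟩

/-- The 5-cycles form two classes in A₅, exchanged by squaring; stability under squaring merges
them. -/
lemma alt5_classes : ∀ h : alternatingGroup (Fin 5), h = 1 ∨
    (h ≠ 1 ∧ h * h = 1 ∧ ∃ g, g * alt5Double * g⁻¹ = h) ∨
    (h ≠ 1 ∧ h * h ≠ 1 ∧ h * h * h = 1 ∧ ∃ g, g * alt5Three * g⁻¹ = h) ∨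
    (h ≠ 1 ∧ h * h ≠ 1 ∧ h * h * h ≠ 1 ∧
      ∃ g, g * alt5Five * g⁻¹ = h ∨ g * alt5Five ^ 2 * g⁻¹ = h) := by
  decide +kernel

lemma alt5_count : ∀ p q r : Bool,
    ({h : alternatingGroup (Fin 5) | h = 1 ∨ (h ≠ 1 ∧ h * h = 1 ∧ p) ∨
      (h ≠ 1 ∧ h * h ≠ 1 ∧ h * h * h = 1 ∧ q) ∨
      (h ≠ 1 ∧ h * h ≠ 1 ∧ h * h * h ≠ 1 ∧ r)} : Finset _).card =
      1 + 15 * p.toNat + 20 * q.toNat + 24 * r.toNat := by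
  decide +kernel

lemma IsEigenLike.card_alt5 {E : alternatingGroup (Fin 5) → Prop} (hE : IsEigenLike E) :
    (Nat.card {h // E h} : ℚ) / Nat.card (alternatingGroup (Fin 5)) ∈
      ({1 / 60, 4 / 15, 7 / 20, 5 / 12, 3 / 5, 2 / 3, 3 / 4, 1} : Set ℚ) := by
  classical
  have hcard : Nat.card (alternatingGroup (Fin 5)) = 60 := by
    rw [Nat.card_eq_fintype_card]
    decide +kernel
  have hcount := alt5_count (decide (E alt5Double)) (decide (E alt5Three))
    (decide (E alt5Five))
  rw [← Nat.subtype_card (p := E) _ fun h => ?_] at hcount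
  · rw [hcount, hcard]
    by_cases hp : E alt5Double <;> by_cases hq : E alt5Three <;>
      by_cases hr : E alt5Five <;> simp [hp, hq, hr] <;> norm_num
  · simp only [Finset.mem_filter, Finset.mem_univ, true_and, decide_eq_true_eq]
    rcases alt5_classes h with rfl | ⟨h1, h2, g, hg⟩ | ⟨h1, h2, h3, g, hg⟩ | ⟨h1, h2, h3, g, hg⟩
    · simp [hE.one]
    · have : E h ↔ E alt5Double := by rw [← hg, hE.conj]
      simp [h1, h2, this]
    · have : E h ↔ E alt5Three := by rw [← hg, hE.conj]
      simp [h1, h2, h3, this]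
    · have : E h ↔ E alt5Five := by
        rcases hg with hg | hg
        · rw [← hg, hE.conj]
        · rw [← hg, hE.conj, hE.sq _ (by decide +kernel)]
      simp [h1, h2, h3, this]

variable {ℓ : ℕ} [Fact ℓ.Prime]

lemma isEigenLike_projEigenSet (hℓ : ℓ ≠ 2) {G : Subgroup (GL2 ℓ)} {H : Type*} [Group H]
    (e : projImage G ≃* H) : IsEigenLike fun h => (e.symm h : PGL2 ℓ) ∈ projEigenSet ℓ where
  one := by
    rw [map_one, Subgroup.coe_one, ← ProjGenLinGroup.mk_one, mk_mem_projEigenSet_iff hℓ]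
    exact center_subset_eigenSet hℓ (one_mem _)
  conj g h := by
    simp only [map_mul, map_inv, Subgroup.coe_mul, Subgroup.coe_inv]
    obtain ⟨x, hx⟩ := ProjGenLinGroup.mk_surjective (e.symm g : PGL2 ℓ)
    obtain ⟨y, hy⟩ := ProjGenLinGroup.mk_surjective (e.symm h : PGL2 ℓ)
    rw [← hx, ← hy, ← map_inv, ← map_mul, ← map_mul, mk_mem_projEigenSet_iff hℓ,
      mk_mem_projEigenSet_iff hℓ, conj_mem_eigenSet_iff hℓ]
  inv h := by
    simp only [map_inv, Subgroup.coe_inv]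
    obtain ⟨y, hy⟩ := ProjGenLinGroup.mk_surjective (e.symm h : PGL2 ℓ)
    rw [← hy, ← map_inv, mk_mem_projEigenSet_iff hℓ, mk_mem_projEigenSet_iff hℓ]
    exact ⟨fun h => by simpa using inv_mem_eigenSet hℓ h, inv_mem_eigenSet hℓ⟩
  sq h hh := by
    have hne : (e.symm h : PGL2 ℓ) ^ 2 ≠ 1 := by
      intro h0
      refine hh (e.symm.injective (Subtype.ext ?_))
      simpa using h0
    simp only [map_pow, Subgroup.coe_pow]
    obtain ⟨y, hy⟩ := ProjGenLinGroup.mk_surjective (e.symm h : PGL2 ℓ)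
    rw [← hy, ← map_pow, Ne, ProjGenLinGroup.mk_eq_one] at hne
    rw [← hy, ← map_pow, mk_mem_projEigenSet_iff hℓ, mk_mem_projEigenSet_iff hℓ,
      sq_mem_eigenSet_iff hℓ hne]

lemma eigenProportion_eq_of_mulEquiv (hℓ : ℓ ≠ 2) {G : Subgroup (GL2 ℓ)} {H : Type*} [Group H]
    (e : projImage G ≃* H) :
    eigenProportion G = (Nat.card {h // (e.symm h : PGL2 ℓ) ∈ projEigenSet ℓ} : ℚ) /
      (Nat.card H : ℚ) := by
  rw [eigenProportion_eq_proj hℓ, Nat.card_congr e.toEquiv]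
  congr 2
  refine Nat.card_eq_of_bijective (fun x : ↥((projImage G : Set (PGL2 ℓ)) ∩ projEigenSet ℓ) =>
    (⟨e ⟨x.1, x.2.1⟩, by simpa using x.2.2⟩ :
      {h // (e.symm h : PGL2 ℓ) ∈ projEigenSet ℓ})) ⟨?_, ?_⟩
  · intro x y h
    simpa [Subtype.ext_iff] using h
  · rintro ⟨h, hh⟩
    exact ⟨⟨e.symm h, (e.symm h).2, hh⟩, by simp⟩

/-! ### Excluding F(G) = 1 for types Cn and Nn. -/

theorem eigenProportion_ne_one_of_nonsplitCartan (hℓ : ℓ ≠ 2) {ε : ZMod ℓ} (hε : ¬ IsSquare ε)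
    {G : Subgroup (GL2 ℓ)} (h : ConjInto G (nonsplitCartan ℓ ε))
    (hn : ¬ ConjInto G (splitCartan ℓ)) : eigenProportion G ≠ 1 := by
  obtain ⟨g, hg⟩ := h
  rw [Ne, eigenProportion_eq_one_iff]
  refine fun hall => hn ⟨g, fun γ hγ => mem_splitCartan_of_mem_center ?_⟩
  exact mem_center_of_mem_nonsplitCartan hℓ hε (hg γ hγ)
    ((conj_mem_eigenSet_iff hℓ g γ).mpr (hall γ hγ))

/-- An element of the normalizer of the non-split Cartan subgroup, not in the subgroup itself,
is diagonalizable if it has an eigenvalue. -/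
lemma exists_conj_mem_splitCartan (hℓ : ℓ ≠ 2) {ε : ZMod ℓ} (hε : ¬ IsSquare ε) {γ : GL2 ℓ}
    (h : γ ∈ nonsplitCartanNormalizer ℓ ε) (hn : γ ∉ nonsplitCartan ℓ ε)
    (he : γ ∈ eigenSet ℓ) : ∃ k : GL2 ℓ, k * γ * k⁻¹ ∈ splitCartan ℓ := by
  have h2 := two_ne_zero_of_ne_two hℓ
  obtain ⟨a, b, hγ⟩ := val_eq_of_mem_nonsplitCartanNormalizer h hn
  by_cases hb : b = 0
  · exact ⟨1, a, -a, by simp [hγ, hb]⟩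
  have hε0 : ε ≠ 0 := fun h => hε (h ▸ IsSquare.zero)
  rw [mem_eigenSet_iff_of_trace_eq_zero hℓ (by simp [hγ, trace_fin_two])] at he
  obtain ⟨c, hc⟩ := he
  have hc0 : c ≠ 0 := by
    rintro rfl
    exact GeneralLinearGroup.det_ne_zero γ (neg_eq_zero.mp (by rw [hc, mul_zero]))
  rw [hγ] at hc
  simp [det_fin_two] at hc
  -- The columns are eigenvectors of γ for c and −c, where c² = −det γ = a² − εb².
  have hdet : (!![ε * b, ε * b; c - a, -c - a] : Matrix (Fin 2) (Fin 2) (ZMod ℓ)).det ≠ 0 := by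
    have : (!![ε * b, ε * b; c - a, -c - a] : Matrix (Fin 2) (Fin 2) (ZMod ℓ)).det =
        -(2 * ε * b * c) := by
      simp [det_fin_two]
      ring
    rw [this]
    exact neg_ne_zero.mpr (mul_ne_zero (mul_ne_zero (mul_ne_zero h2 hε0) hb) hc0)
  let k := GeneralLinearGroup.mkOfDetNeZero _ hdet
  have hdiag : (!![c, 0; 0, -c] : Matrix (Fin 2) (Fin 2) (ZMod ℓ)).det ≠ 0 := by
    simp [det_fin_two, hc0]
  let d := GeneralLinearGroup.mkOfDetNeZero _ hdiag
  have hkd : γ * k = k * d := by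
    refine Units.ext ?_
    change γ.1 * !![ε * b, ε * b; c - a, -c - a] =
      !![ε * b, ε * b; c - a, -c - a] * !![c, 0; 0, -c]
    rw [hγ]
    ext i j
    fin_cases i <;> fin_cases j <;> simp
    · ring
    · ring
    · linear_combination hc
    · linear_combination hc
  refine ⟨k⁻¹, c, -c, ?_⟩
  have : k⁻¹ * γ * k⁻¹⁻¹ = d := by rw [inv_inv, mul_assoc, hkd, inv_mul_cancel_left]
  rw [this]
  rfl

/-- If every element had an eigenvalue, the Cartan part of the conjugated group would be scalar. The
group would then be generated by scalars and one diagonalizable element g₀, hence be conjugate into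
the split Cartan. -/
theorem eigenProportion_ne_one_of_nonsplitCartanNormalizer (hℓ : ℓ ≠ 2) {ε : ZMod ℓ}
    (hε : ¬ IsSquare ε) {G : Subgroup (GL2 ℓ)} (h : ConjInto G (nonsplitCartanNormalizer ℓ ε))
    (hs : ¬ ConjInto G (splitCartanNormalizer ℓ)) (hn : ¬ ConjInto G (nonsplitCartan ℓ ε)) :
    eigenProportion G ≠ 1 := by
  obtain ⟨g, hg⟩ := h.forall_mem_conjSubgroup
  replace hn : ¬ ConjInto (conjSubgroup g G) (nonsplitCartan ℓ ε) := fun h => hn h.of_conjSubgroup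
  replace hs : ¬ ConjInto (conjSubgroup g G) (splitCartanNormalizer ℓ) :=
    fun h => hs h.of_conjSubgroup
  rw [← eigenProportion_conjSubgroup hℓ g]
  generalize conjSubgroup g G = G' at hg hn hs ⊢
  rw [Ne, eigenProportion_eq_one_iff]
  intro hall
  obtain ⟨g₀, hg₀, hg₀'⟩ : ∃ γ ∈ G', γ ∉ nonsplitCartan ℓ ε := by
    by_contra! hc
    exact hn ⟨1, by simpa using hc⟩
  obtain ⟨k, hk⟩ := exists_conj_mem_splitCartan hℓ hε (hg g₀ hg₀) hg₀' (hall g₀ hg₀)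
  have hcen : ∀ γ ∈ G', γ ∈ nonsplitCartan ℓ ε → k * γ * k⁻¹ ∈ splitCartan ℓ := by
    intro γ hγ hγ'
    have hz := mem_center_of_mem_nonsplitCartan hℓ hε hγ' (hall γ hγ)
    exact mem_splitCartan_of_mem_center (Subgroup.Normal.conj_mem inferInstance _ hz k)
  have hsub : ∀ x ∈ splitCartan ℓ, x ∈ splitCartanNormalizer ℓ := fun x hx => Or.inl hx
  refine hs ⟨k, fun γ hγ => hsub _ ?_⟩
  by_cases hγ' : γ ∈ nonsplitCartan ℓ ε
  · exact hcen γ hγ hγ'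
  · have hγ₀ : g₀⁻¹ * γ ∈ G' := G'.mul_mem (G'.inv_mem hg₀) hγ
    have h1 := mul_mem_nonsplitCartan_iff hℓ (hg _ hg₀) (hg _ hγ₀)
    rw [mul_inv_cancel_left] at h1
    have h2 := hcen _ hγ₀ (by tauto)
    have h3 := (mul_mem_splitCartan_iff (hsub _ hk) (hsub _ h2)).mpr (by tauto)
    have h4 : k * γ * k⁻¹ = k * g₀ * k⁻¹ * (k * (g₀⁻¹ * γ) * k⁻¹) := by group
    rw [h4]
    exact h3

end EigenProportion

/-! ### Assembly of all types. -/

theorem mainTheorem3 (ℓ : ℕ) [Fact ℓ.Prime] (hℓ : ℓ ≠ 2) (ε : ZMod ℓ) (hε : ¬ IsSquare ε)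
    (G : Subgroup (GL2 ℓ)) :
    (HasType ε G .Cs ∨ HasType ε G .B → eigenProportion G = 1) ∧
    (HasType ε G .Cn → eigenProportion G = 1 / (Nat.card (projImage G) : ℚ)) ∧
    (HasType ε G .PSL → eigenProportion G = ((ℓ : ℚ) + 3) / (2 * ((ℓ : ℚ) + 1))) ∧
    (HasType ε G .PGL → eigenProportion G = ((ℓ : ℚ) + 2) / (2 * ((ℓ : ℚ) + 1))) ∧
    (HasType ε G .Ns → eigenProportion G ∈ ({1 / 2, 3 / 4, 1} : Set ℚ)) ∧
    (HasType ε G .Nn → eigenProportion G ∈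
      ({1 / (Nat.card (projImage G) : ℚ), 1 / 4 + 1 / (Nat.card (projImage G) : ℚ),
        1 / 2 + 1 / (Nat.card (projImage G) : ℚ)} : Set ℚ)) ∧
    (HasType ε G .A4 → eigenProportion G ∈ ({1 / 12, 1 / 3, 3 / 4, 1} : Set ℚ)) ∧
    (HasType ε G .S4 → eigenProportion G ∈
      ({1 / 24, 7 / 24, 3 / 8, 5 / 12, 5 / 8, 2 / 3, 3 / 4, 1} : Set ℚ)) ∧
    (HasType ε G .A5 → eigenProportion G ∈
      ({1 / 60, 4 / 15, 7 / 20, 5 / 12, 3 / 5, 2 / 3, 3 / 4, 1} : Set ℚ)) ∧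
    (HasType ε G .Cn ∨ HasType ε G .Nn ∨ HasType ε G .PSL ∨ HasType ε G .PGL →
      eigenProportion G ≤ 3 / 4) ∧
    (eigenProportion G ≠ 1 → eigenProportion G ≤ 3 / 4) := by
  -- The PSL value is at most 3/4 exactly when ℓ ≥ 3, with equality at ℓ = 3.
  have hl : (3 : ℚ) ≤ ℓ := by
    have h2 := (Fact.out : ℓ.Prime).two_le
    exact_mod_cast (by omega : 3 ≤ ℓ)
  refine ⟨?_, ?_, ?_, ?_, ?_, ?_, ?_, ?_, ?_, ?_, eigenProportion_le_of_ne_one hℓ G⟩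
  · rintro (⟨-, g, hg⟩ | ⟨-, h, -⟩)
    · exact eigenProportion_eq_one_of_conjInto_borel hℓ
        ⟨g, fun γ hγ => splitCartan_subset_borel (hg γ hγ)⟩
    · exact eigenProportion_eq_one_of_conjInto_borel hℓ h
  · rintro ⟨-, h, -⟩
    exact eigenProportion_of_conjInto_nonsplitCartan hℓ hε h
  · rintro ⟨-, h⟩
    exact eigenProportion_of_projImage_eq_PSL2 hℓ h
  · rintro ⟨-, h⟩
    exact eigenProportion_of_projImage_eq_top hℓ h
  · rintro ⟨-, h, hn, -⟩
    exact eigenProportion_of_conjInto_splitCartanNormalizer hℓ h hn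
  · rintro ⟨-, h, -, hn⟩
    exact eigenProportion_of_conjInto_nonsplitCartanNormalizer hℓ hε h hn
  · rintro ⟨-, ⟨e⟩⟩
    rw [eigenProportion_eq_of_mulEquiv hℓ e]
    exact (isEigenLike_projEigenSet hℓ e).card_alt4
  · rintro ⟨-, ⟨e⟩⟩
    rw [eigenProportion_eq_of_mulEquiv hℓ e]
    exact (isEigenLike_projEigenSet hℓ e).card_perm4
  · rintro ⟨-, ⟨e⟩⟩
    rw [eigenProportion_eq_of_mulEquiv hℓ e]
    exact (isEigenLike_projEigenSet hℓ e).card_alt5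
  · rintro (⟨-, h, hn⟩ | ⟨-, h, hs, hn⟩ | ⟨-, h⟩ | ⟨-, h⟩)
    · exact eigenProportion_le_of_ne_one hℓ G
        (eigenProportion_ne_one_of_nonsplitCartan hℓ hε h hn)
    · exact eigenProportion_le_of_ne_one hℓ G
        (eigenProportion_ne_one_of_nonsplitCartanNormalizer hℓ hε h hs hn)
    · rw [eigenProportion_of_projImage_eq_PSL2 hℓ h, div_le_iff₀ (by linarith)]
      linarith
    · rw [eigenProportion_of_projImage_eq_top hℓ h, div_le_iff₀ (by linarith)]
      linarith
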